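/- Let $n\ge 3$ and let $\mathcal C_n$ be the weighted cycle on vertices $0,\dots,n-1$ in which the edge $\{i,i+1\}$ (indices mod $n$) has conductance $c_i>0$. Let $L$ be its weighted Laplacian, with eigenvalues $0=\lambda_0<\lambda_1\le\lambda_2\le\cdots\le\lambda_{n-1}$ (with multiplicity). A unit Fiedler vector is a vector $u_1\perp\mathbf 1$ with $\|u_1\|_2=1$ and $Lu_1=\lambda_1u_1$. Put $r_i=1/c_i$, $S=\sum_{i=0}^{n-1} r_i$, $\bar r=S/n$, $s_i=\sum_{k=0}^{i-1}r_k$, $r_{\max}=\max_i r_i$, and $$\delta_n=\frac1S\max_{0\le p\le n-1}\ \max_{1\le\ell\le n}\left|\sum_{j=0}^{\ell-1}r_{p+j}-\frac{\ell}{n}S\right|+\frac{r_{\max}}{S}$$ (indices mod $n$). **Theorem.** For every real $\kappa\ge1$ there are constants $\delta_0,C_\kappa,C'_\kappa>0$, depending only on $\kappa$, such that for every $n\ge3$ and all conductances with $1\le c_i\le\kappa$ for all $i$ and $\delta_n\le\delta_0$ the following hold. (a) For every unit Fiedler vector $u_1$ there are a phase $\phi\in\mathbb R$ and a sign $\sigma\in\{\pm1\}$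 with $$\max_{0\le i\le n-1}\left|u_{1,i}-\sigma\sqrt{\tfrac2n}\,\sin\!\left(\tfrac{2\pi s_i}{S}+\phi\right)\right|\le C_\kappa\sqrt{\tfrac{\delta_n}{n}}.\tag{1}$$ (b) $\lambda_1\le\bar r\left(\tfrac{2\pi}{S}\right)^2(1+C_\kappa\delta_n)$. (c) For every unit Fiedler vector $u_1$ and every phase $\phi$ and sign $\sigma$ satisfying (1), there are a vector $u_2$ with $\|u_2\|_2=1$, $Lu_2=\lambda_2u_2$, $u_2\perp u_1$, $u_2\perp\mathbf 1$, and a sign $\tau\in\{\pm1\}$ with $$\max_{0\le i\le n-1}\left|u_{2,i}-\tau\sqrt{\tfrac2n}\,\cos\!\left(\tfrac{2\pi s_i}{S}+\phi\right)\right|\le C'_\kappa\sqrt{\tfrac{\delta_n}{n}}.$$ (d) $\lambda_2\le\bar r\left(\tfrac{2\pi}{S}\right)^2(1+C'_\kappa\delta_n)$. -/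

import Mathlib

open scoped Matrix

noncomputable section

namespace WeightedCycle

/-- Laplacian `L = D - A` of a weighted graph with adjacency matrix `A`, where `D` is the diagonal
matrix of weighted degrees `d i = ∑ j, A i j`. -/
def laplacian {n : ℕ} (A : Matrix (Fin n) (Fin n) ℝ) : Matrix (Fin n) (Fin n) ℝ :=
  Matrix.diagonal (fun i => ∑ j, A i j) - A

/-- Adjacency matrix of the weighted cycle on the vertices `0, …, n - 1`, in which the edge
`{i, i + 1}` (indices modulo `n`) has conductance `c i`. For `n ≥ 3` at most one of the two
summands is nonzero. -/
def adjacency {n : ℕ} [NeZero n] (c : Fin n → ℝ) : Matrix (Fin n) (Fin n) ℝ :=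
  Matrix.of fun i j => (if j = i + 1 then c i else 0) + (if i = j + 1 then c j else 0)

/-- Laplacian of the weighted cycle with conductances `c`. -/
def cycleLaplacian {n : ℕ} [NeZero n] (c : Fin n → ℝ) : Matrix (Fin n) (Fin n) ℝ :=
  laplacian (adjacency c)

theorem cycleLaplacian_isHermitian {n : ℕ} [NeZero n] (c : Fin n → ℝ) :
    (cycleLaplacian c).IsHermitian := by
  have hA : (adjacency c).IsHermitian := by
    ext i j
    simp [adjacency, Matrix.conjTranspose_apply, add_comm]
  exact (Matrix.isHermitian_diagonal _).sub hA

/-- The eigenvalues `lam c 0 ≤ lam c 1 ≤ ⋯ ≤ lam c (n - 1)` of the cycle Laplacian, counted with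
multiplicity and listed in increasing order (`eigenvalues₀` lists them in decreasing order). -/
def lam {n : ℕ} [NeZero n] (c : Fin n → ℝ) (k : Fin n) : ℝ :=
  (cycleLaplacian_isHermitian c).eigenvalues₀ (Fin.cast (Fintype.card_fin n).symm k.rev)

/-- `u` is a vector of Euclidean norm one, orthogonal to the all-ones vector, with
`L u = lam c k • u`. -/
def IsUnitEigenvector {n : ℕ} [NeZero n] (c : Fin n → ℝ) (k : Fin n) (u : Fin n → ℝ) : Prop :=
  u ⬝ᵥ u = 1 ∧ u ⬝ᵥ 1 = 0 ∧ cycleLaplacian c *ᵥ u = lam c k • u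

/-- Edge resistances `r i = 1 / c i`. -/
def res {n : ℕ} (c : Fin n → ℝ) (i : Fin n) : ℝ := 1 / c i

/-- Total resistance `S` of the cycle. -/
def totalRes {n : ℕ} (c : Fin n → ℝ) : ℝ := ∑ i, res c i

/-- Mean edge resistance `S / n`. -/
def meanRes {n : ℕ} (c : Fin n → ℝ) : ℝ := totalRes c / n

/-- Resistance arclength `s i = r 0 + ⋯ + r (i - 1)` of the vertex `i`. -/
def arclength {n : ℕ} (c : Fin n → ℝ) (i : Fin n) : ℝ := ∑ k ∈ Finset.Iio i, res c k

/-- Cumulative resistance `r p + ⋯ + r (p + ℓ - 1)` of `ℓ` consecutive edges, indices modulo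
`n`. -/
def cumRes {n : ℕ} [NeZero n] (c : Fin n → ℝ) (p : Fin n) (ℓ : ℕ) : ℝ :=
  ∑ j ∈ Finset.range ℓ, res c (p + Fin.ofNat n j)

/-- `D = max_{p} max_{1 ≤ ℓ ≤ n} |A_{p,ℓ} - (ℓ / n) S|`; the suprema are over finite nonempty
sets. -/
def maxDeviation {n : ℕ} [NeZero n] (c : Fin n → ℝ) : ℝ :=
  ⨆ p : Fin n, ⨆ ℓ : Set.Icc 1 n, |cumRes c p ℓ - ((ℓ : ℕ) : ℝ) / n * totalRes c|

/-- Largest edge resistance. -/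
def maxRes {n : ℕ} (c : Fin n → ℝ) : ℝ := ⨆ i, res c i

/-- The discrepancy `δ = D / S + r_max / S`. -/
def discrepancy {n : ℕ} [NeZero n] (c : Fin n → ℝ) : ℝ :=
  maxDeviation c / totalRes c + maxRes c / totalRes c

/-- `|u i - σ √(2/n) sin (2π s_i / S + φ)| ≤ C √(δ / n)` for all vertices `i`. -/
def NearSine {n : ℕ} [NeZero n] (c : Fin n → ℝ) (C : ℝ) (u : Fin n → ℝ) (φ σ : ℝ) : Prop :=
  ∀ i, |u i - σ * √(2 / n) * Real.sin (2 * Real.pi * arclength c i / totalRes c + φ)|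
    ≤ C * √(discrepancy c / n)

/-- `|u i - τ √(2/n) cos (2π s_i / S + φ)| ≤ C √(δ / n)` for all vertices `i`. -/
def NearCosine {n : ℕ} [NeZero n] (c : Fin n → ℝ) (C : ℝ) (u : Fin n → ℝ) (φ τ : ℝ) : Prop :=
  ∀ i, |u i - τ * √(2 / n) * Real.cos (2 * Real.pi * arclength c i / totalRes c + φ)|
    ≤ C * √(discrepancy c / n)

end WeightedCycle

end

noncomputable section

namespace WeightedCycle

/-! Put θ_i = 2π s_i / S and R = r̄ (2π/S)². The proof has an upper bound for λ₂, a rigidity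
statement for eigenvectors below that bound, and an orthogonality argument for the phases.

Upper bound (`lam_two_le`): the trial space is spanned by sin θ_i, cos θ_i and 1. On each edge
Cauchy–Schwarz bounds c_i (Δ sin)² by (2π/S) ∫ cos², because c_i r_i = 1; the integrals telescope
around the cycle. The angles θ_i lie within 2πδ of equally spaced ones, so the ℓ² mass is the
uniform one up to O(δ). Min-max then gives λ₁ ≤ λ₂ ≤ R (1 + 64δ).

Rigidity (`exists_amplitude_near`, `exists_phase_near`): the eigenvalue equation is a first-order
recurrence for the pair (potential, current). With T = √(nSμ) and after a correction absorbing the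
fluctuation of r_i, each step is a rotation by T/n up to error O(δ/n), so n steps cost O(δ)
(`norm_sub_rotation_le`). Closing up around the cycle forces exp(iT) ≈ 1; a Poincaré inequality
excludes T ≈ 0 and the upper bound excludes further turns, so T ≈ 2π. Unit norm fixes the amplitude
near √(2/n). No spectral gap or eigenvector perturbation theory enters.

Phases: an eigenvector for λ₂ orthogonal to u₁ is also a sine wave, and orthogonality makes the
cosine of the phase difference O(√δ) (`abs_cos_sub_le`), which turns the sine into ± a cosine
(`nearCosine_of_phase`). -/

/-! ### Dirichlet form, spectral decomposition and min-max. -/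

theorem cycleLaplacian_mulVec {n : ℕ} [NeZero n] (c u : Fin n → ℝ) (i : Fin n) :
    (cycleLaplacian c *ᵥ u) i = c i * (u i - u (i + 1)) + c (i - 1) * (u i - u (i - 1)) := by
  have h : (cycleLaplacian c *ᵥ u) i = ∑ j, adjacency c i j * (u i - u j) := by
    simp only [cycleLaplacian, laplacian, Matrix.sub_mulVec, Pi.sub_apply, Matrix.mulVec_diagonal,
      mul_sub, Finset.sum_sub_distrib, ← Finset.sum_mul]
    rfl
  have h' : ∀ j, (i = j + 1) ↔ (j = i - 1) := fun j =>
    ⟨fun h => by rw [h]; abel, fun h => by rw [h]; abel⟩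
  rw [h]
  simp only [adjacency, Matrix.of_apply, add_mul, Finset.sum_add_distrib, ite_mul, zero_mul, h',
    Finset.sum_ite_eq', Finset.mem_univ, if_true]

theorem dotProduct_cycleLaplacian_mulVec {n : ℕ} [NeZero n] (c u : Fin n → ℝ) :
    u ⬝ᵥ (cycleLaplacian c *ᵥ u) = ∑ i, c i * (u (i + 1) - u i) ^ 2 := by
  have h : ∑ i, u i * (c (i - 1) * (u i - u (i - 1)))
      = ∑ i, u (i + 1) * (c i * (u (i + 1) - u i)) := by
    rw [← Equiv.sum_comp (Equiv.addRight (1 : Fin n))]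
    simp
  simp only [dotProduct, cycleLaplacian_mulVec, mul_add, Finset.sum_add_distrib]
  rw [h, ← Finset.sum_add_distrib]
  exact Finset.sum_congr rfl fun i _ => by ring

/-- Orthonormal eigenvectors of the cycle Laplacian, `eigvec c k` belonging to `lam c k`. -/
def eigvec {n : ℕ} [NeZero n] (c : Fin n → ℝ) (k : Fin n) : Fin n → ℝ :=
  ((cycleLaplacian_isHermitian c).eigenvectorBasis
    (Fintype.equivOfCardEq (Fintype.card_fin _)
      (Fin.cast (Fintype.card_fin n).symm k.rev))).ofLp

/-- The indexing of the spectral basis by increasing eigenvalue. -/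
def spectralIndex (n : ℕ) [NeZero n] : Fin n ≃ Fin n :=
  Fin.revPerm.trans ((finCongr (Fintype.card_fin n).symm).trans
    (Fintype.equivOfCardEq (Fintype.card_fin _)))

theorem eigvec_eq {n : ℕ} [NeZero n] (c : Fin n → ℝ) (k : Fin n) :
    eigvec c k = ((cycleLaplacian_isHermitian c).eigenvectorBasis (spectralIndex n k)).ofLp := rfl

theorem lam_eq {n : ℕ} [NeZero n] (c : Fin n → ℝ) (k : Fin n) :
    lam c k = (cycleLaplacian_isHermitian c).eigenvalues (spectralIndex n k) := by
  simp [lam, Matrix.IsHermitian.eigenvalues, spectralIndex]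

theorem lam_mono {n : ℕ} [NeZero n] (c : Fin n → ℝ) : Monotone (lam c) := by
  intro k l h
  apply (cycleLaplacian_isHermitian c).eigenvalues₀_antitone
  simpa using h

theorem cycleLaplacian_mulVec_eigvec {n : ℕ} [NeZero n] (c : Fin n → ℝ) (k : Fin n) :
    cycleLaplacian c *ᵥ eigvec c k = lam c k • eigvec c k := by
  rw [eigvec_eq, lam_eq]
  exact (cycleLaplacian_isHermitian c).mulVec_eigenvectorBasis _

theorem eigvec_dotProduct {n : ℕ} [NeZero n] (c : Fin n → ℝ) (k l : Fin n) :
    eigvec c k ⬝ᵥ eigvec c l = if k = l then 1 else 0 := by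
  have h := (cycleLaplacian_isHermitian c).eigenvectorBasis.inner_eq_ite
    (spectralIndex n l) (spectralIndex n k)
  rw [EuclideanSpace.inner_eq_star_dotProduct] at h
  simpa [eigvec_eq, eq_comm] using h

theorem dotProduct_self_eq_sum {n : ℕ} [NeZero n] (c f : Fin n → ℝ) :
    f ⬝ᵥ f = ∑ k, (eigvec c k ⬝ᵥ f) ^ 2 := by
  have h := (cycleLaplacian_isHermitian c).eigenvectorBasis.sum_inner_mul_inner
    (WithLp.toLp 2 f) (WithLp.toLp 2 f)
  rw [← Equiv.sum_comp (spectralIndex n)] at h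
  simp only [EuclideanSpace.inner_eq_star_dotProduct] at h
  simp only [star_trivial] at h
  rw [← h]
  refine Finset.sum_congr rfl fun k _ => ?_
  rw [eigvec_eq, sq, dotProduct_comm f]

theorem dotProduct_cycleLaplacian_comm {n : ℕ} [NeZero n] (c f g : Fin n → ℝ) :
    f ⬝ᵥ (cycleLaplacian c *ᵥ g) = g ⬝ᵥ (cycleLaplacian c *ᵥ f) := by
  have h : (cycleLaplacian c)ᵀ = cycleLaplacian c := by
    simpa [Matrix.IsHermitian] using cycleLaplacian_isHermitian c
  rw [Matrix.dotProduct_mulVec, ← Matrix.mulVec_transpose, h, dotProduct_comm]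

theorem eq_sum_eigvec {n : ℕ} [NeZero n] (c f : Fin n → ℝ) :
    f = ∑ k, (eigvec c k ⬝ᵥ f) • eigvec c k := by
  have h := (cycleLaplacian_isHermitian c).eigenvectorBasis.sum_repr' (WithLp.toLp 2 f)
  rw [← Equiv.sum_comp (spectralIndex n)] at h
  have h2 := congrArg WithLp.ofLp h
  simp only [WithLp.ofLp_sum, WithLp.ofLp_smul, EuclideanSpace.inner_eq_star_dotProduct,
    star_trivial] at h2
  conv_lhs => rw [← h2]
  refine Finset.sum_congr rfl fun k _ => ?_
  rw [eigvec_eq, dotProduct_comm]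

theorem dotProduct_cycleLaplacian_eq_sum {n : ℕ} [NeZero n] (c f : Fin n → ℝ) :
    f ⬝ᵥ (cycleLaplacian c *ᵥ f) = ∑ k, lam c k * (eigvec c k ⬝ᵥ f) ^ 2 := by
  have h : ∀ k, eigvec c k ⬝ᵥ (cycleLaplacian c *ᵥ f) = lam c k * (eigvec c k ⬝ᵥ f) := by
    intro k
    rw [dotProduct_cycleLaplacian_comm, cycleLaplacian_mulVec_eigvec, dotProduct_smul,
      dotProduct_comm, smul_eq_mul]
  conv_lhs => rw [eq_sum_eigvec c f, ← eq_sum_eigvec c f, dotProduct_comm]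
  rw [dotProduct_comm]
  conv_lhs => lhs; rw [eq_sum_eigvec c f]
  rw [sum_dotProduct]
  refine Finset.sum_congr rfl fun k _ => ?_
  rw [smul_dotProduct, h, smul_eq_mul]
  ring

theorem apply_eq_of_dotProduct_mulVec_eq_zero {n : ℕ} [NeZero n] {c : Fin n → ℝ} (hc : ∀ i, 0 < c i)
    {u : Fin n → ℝ} (h : u ⬝ᵥ (cycleLaplacian c *ᵥ u) = 0) (i : Fin n) : u i = u 0 := by
  rw [dotProduct_cycleLaplacian_mulVec,
    Finset.sum_eq_zero_iff_of_nonneg fun i _ => mul_nonneg (hc i).le (sq_nonneg _)] at h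
  have h1 : ∀ i, u (i + 1) = u i := fun i => by
    have := h i (Finset.mem_univ i)
    rw [mul_eq_zero, or_iff_right (hc i).ne', sq_eq_zero_iff] at this
    linarith
  have h2 : ∀ m : ℕ, u (Fin.ofNat n m) = u 0 := fun m => by
    induction m with
    | zero => rfl
    | succ m ih =>
      rw [← ih, ← h1 (Fin.ofNat n m)]
      congr 1
      ext
      simp [Fin.val_add]
  simpa using h2 i

theorem lam_nonneg {n : ℕ} [NeZero n] {c : Fin n → ℝ} (hc : ∀ i, 0 < c i) (k : Fin n) :
    0 ≤ lam c k := by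
  have h := dotProduct_cycleLaplacian_mulVec c (eigvec c k)
  rw [cycleLaplacian_mulVec_eigvec, dotProduct_smul, eigvec_dotProduct, if_pos rfl] at h
  simp only [smul_eq_mul, mul_one] at h
  rw [h]
  exact Finset.sum_nonneg fun i _ => mul_nonneg (hc i).le (sq_nonneg _)

/-- Otherwise `eigvec c 0` and `eigvec c k` would be two orthonormal constant vectors. -/
theorem lam_pos {n : ℕ} [NeZero n] {c : Fin n → ℝ} (hc : ∀ i, 0 < c i) {k : Fin n} (hk : 0 < k) :
    0 < lam c k := by
  refine lt_of_le_of_ne (lam_nonneg hc k) fun h => ?_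
  have h0 : lam c 0 = 0 :=
    le_antisymm (h ▸ lam_mono c hk.le) (lam_nonneg hc 0)
  have hconst : ∀ l, lam c l = 0 → ∀ i, eigvec c l i = eigvec c l 0 := fun l hl =>
    apply_eq_of_dotProduct_mulVec_eq_zero hc (by rw [cycleLaplacian_mulVec_eigvec, hl]; simp)
  have e0 := eigvec_dotProduct c 0 0
  have ek := eigvec_dotProduct c k k
  have e1 := eigvec_dotProduct c k 0
  simp only [dotProduct, hconst k h.symm, hconst 0 h0, Finset.sum_const, hk.ne', if_true, if_false,
    Finset.card_univ, nsmul_eq_mul, mul_eq_zero] at e0 ek e1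
  rcases e1 with e | e | e
  · rw [e, zero_mul] at ek
    exact zero_ne_one ek
  · rw [e, mul_zero, mul_zero] at ek
    exact zero_ne_one ek
  · rw [e, mul_zero, mul_zero] at e0
    exact zero_ne_one e0

theorem dotProduct_eq_zero_of_ne {n : ℕ} [NeZero n] {c u w : Fin n → ℝ} {a b : ℝ}
    (hu : cycleLaplacian c *ᵥ u = a • u) (hw : cycleLaplacian c *ᵥ w = b • w) (hab : a ≠ b) :
    u ⬝ᵥ w = 0 := by
  have h := dotProduct_cycleLaplacian_comm c u w
  rw [hu, hw, dotProduct_smul, dotProduct_smul, dotProduct_comm w u, smul_eq_mul, smul_eq_mul,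
    ← sub_eq_zero, ← sub_mul, mul_eq_zero, sub_eq_zero] at h
  exact h.resolve_left hab.symm

theorem cycleLaplacian_mulVec_one {n : ℕ} [NeZero n] (c : Fin n → ℝ) :
    cycleLaplacian c *ᵥ 1 = (0 : ℝ) • 1 := by
  ext i
  simp [cycleLaplacian_mulVec]

theorem dotProduct_one_of_mulVec {n : ℕ} [NeZero n] {c : Fin n → ℝ} (hc : ∀ i, 0 < c i)
    {u : Fin n → ℝ} {k : Fin n} (hk : 0 < k) (hu : cycleLaplacian c *ᵥ u = lam c k • u) :
    u ⬝ᵥ 1 = 0 :=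
  dotProduct_eq_zero_of_ne hu (cycleLaplacian_mulVec_one c) (lam_pos hc hk).ne'

/-- A unit eigenvector for the later of two indices can be chosen orthogonal to a given
eigenvector for the earlier one. -/
theorem exists_isUnitEigenvector_orthogonal {n : ℕ} [NeZero n] {c : Fin n → ℝ}
    (hc : ∀ i, 0 < c i) {k l : Fin n} (hk : 0 < k) (hkl : k < l) {u : Fin n → ℝ}
    (hu : IsUnitEigenvector c k u) : ∃ w, IsUnitEigenvector c l w ∧ w ⬝ᵥ u = 0 := by
  have hl := hk.trans hkl
  have key : ∃ w, w ≠ 0 ∧ cycleLaplacian c *ᵥ w = lam c l • w ∧ w ⬝ᵥ u = 0 := by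
    have hne : ∀ j, eigvec c j ≠ 0 := fun j hj => by
      simpa [hj] using eigvec_dotProduct c j j
    by_cases h : lam c k = lam c l
    · by_cases h0 : eigvec c k ⬝ᵥ u = 0
      · exact ⟨eigvec c k, hne k, by rw [cycleLaplacian_mulVec_eigvec, h], h0⟩
      -- Inside a multiple eigenspace, this combination cancels the component along u; it is nonzero
      -- because its coefficient on `eigvec c l` is.
      · refine ⟨(eigvec c k ⬝ᵥ u) • eigvec c l - (eigvec c l ⬝ᵥ u) • eigvec c k, fun hw => ?_, ?_, ?_⟩
        · have := congrArg (fun x => eigvec c l ⬝ᵥ x) hw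
          simp [dotProduct_sub, eigvec_dotProduct, hkl.ne', h0] at this
        · simp only [Matrix.mulVec_sub, Matrix.mulVec_smul, cycleLaplacian_mulVec_eigvec, h,
            smul_sub]
          rw [smul_comm, smul_comm (lam c l) (eigvec c l ⬝ᵥ u)]
        · simp only [sub_dotProduct, smul_dotProduct, smul_eq_mul]
          ring
    · exact ⟨eigvec c l, hne l, cycleLaplacian_mulVec_eigvec c l,
        dotProduct_eq_zero_of_ne (cycleLaplacian_mulVec_eigvec c l) hu.2.2 (Ne.symm h)⟩
  obtain ⟨w, hw0, hwL, hwu⟩ := key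
  have hpos : 0 < w ⬝ᵥ w := by
    refine lt_of_le_of_ne (Finset.sum_nonneg fun i _ => mul_self_nonneg _) fun h => hw0 ?_
    exact dotProduct_self_eq_zero.mp h.symm
  have hs : √(w ⬝ᵥ w) * √(w ⬝ᵥ w) = w ⬝ᵥ w := Real.mul_self_sqrt hpos.le
  have hs0 : √(w ⬝ᵥ w) ≠ 0 := (Real.sqrt_pos.mpr hpos).ne'
  refine ⟨(√(w ⬝ᵥ w))⁻¹ • w, ⟨?_, ?_, ?_⟩, ?_⟩
  · rw [smul_dotProduct, dotProduct_smul, smul_eq_mul, smul_eq_mul]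
    nth_rewrite 3 [← hs]
    field_simp
  · rw [smul_dotProduct, dotProduct_one_of_mulVec hc hl hwL, smul_zero]
  · rw [Matrix.mulVec_smul, hwL, smul_comm]
  · rw [smul_dotProduct, hwu, smul_zero]

/-- Min-max bound: a quadratic-form inequality on the image of a three-parameter family of
vectors bounds the third eigenvalue. -/
theorem exists_rayleigh_le {n : ℕ} [NeZero n] (hn : 3 ≤ n) (c : Fin n → ℝ) (p q r : Fin n → ℝ) :
    ∃ x y z : ℝ, ¬ (x = 0 ∧ y = 0 ∧ z = 0) ∧
      lam c ⟨2, hn⟩ * ((x • p + y • q + z • r) ⬝ᵥ (x • p + y • q + z • r)) ≤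
        (x • p + y • q + z • r) ⬝ᵥ (cycleLaplacian c *ᵥ (x • p + y • q + z • r)) := by
  let k0 : Fin n := ⟨0, by omega⟩
  let k1 : Fin n := ⟨1, by omega⟩
  -- A kernel vector of this 2 × 3 matrix gives a combination of p, q, r orthogonal to the two
  -- lowest eigenvectors.
  let A : Matrix (Fin 2) (Fin 3) ℝ :=
    !![eigvec c k0 ⬝ᵥ p, eigvec c k0 ⬝ᵥ q, eigvec c k0 ⬝ᵥ r;
      eigvec c k1 ⬝ᵥ p, eigvec c k1 ⬝ᵥ q, eigvec c k1 ⬝ᵥ r]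
  have hker : LinearMap.ker A.mulVecLin ≠ ⊥ :=
    LinearMap.ker_ne_bot_of_finrank_lt (by simp)
  obtain ⟨v, hv, hv0⟩ := (Submodule.ne_bot_iff _).mp hker
  rw [LinearMap.mem_ker, Matrix.mulVecLin_apply] at hv
  refine ⟨v 0, v 1, v 2, fun h => hv0 ?_, ?_⟩
  · ext i
    fin_cases i
    exacts [h.1, h.2.1, h.2.2]
  have hv' : ∀ k : Fin n, k < ⟨2, hn⟩ →
      eigvec c k ⬝ᵥ (v 0 • p + v 1 • q + v 2 • r) = 0 := by
    intro k hk
    have hk' : k = k0 ∨ k = k1 := by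
      have : k.val < 2 := hk
      simp only [Fin.ext_iff, k0, k1]
      omega
    have h0 := congrFun hv 0
    have h1 := congrFun hv 1
    simp only [A, Matrix.mulVec, dotProduct, Fin.sum_univ_three, Matrix.of_apply] at h0 h1
    simp only [dotProduct_add, dotProduct_smul, smul_eq_mul]
    rcases hk' with rfl | rfl
    · simpa [mul_comm, dotProduct] using h0
    · simpa [mul_comm, dotProduct] using h1
  rw [dotProduct_cycleLaplacian_eq_sum, dotProduct_self_eq_sum c, Finset.mul_sum]
  refine Finset.sum_le_sum fun k _ => ?_
  rcases lt_or_ge k ⟨2, hn⟩ with hk | hk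
  · simp [hv' k hk]
  · exact mul_le_mul_of_nonneg_right (lam_mono c hk) (sq_nonneg _)

/-! ### Trigonometric sums and the increment of the sine. -/

/-- Real part of a full geometric sum with ratio ζ^m ≠ 1, ζ a primitive n-th root of unity. -/
theorem sum_cos_eq_zero {n m : ℕ} (hm : 0 < m) (hmn : m < n) (α : ℝ) :
    ∑ i : Fin n, Real.cos (m * (2 * Real.pi * i / n) + α) = 0 := by
  have hn : n ≠ 0 := by omega
  have hζ := Complex.isPrimitiveRoot_exp n hn
  set ζ := Complex.exp (2 * Real.pi * Complex.I / n) with hζdef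
  have h1 : ζ ^ m ≠ 1 := hζ.pow_ne_one_of_pos_of_lt hm.ne' hmn
  have h2 : (∑ i ∈ Finset.range n, (ζ ^ m) ^ i) * (ζ ^ m - 1) = 0 := by
    rw [geom_sum_mul, ← pow_mul, mul_comm, pow_mul, hζ.pow_eq_one, one_pow, sub_self]
  have h3 : ∑ i ∈ Finset.range n, (ζ ^ m) ^ i = 0 :=
    (mul_eq_zero.mp h2).resolve_right (sub_ne_zero.mpr h1)
  rw [Fin.sum_univ_eq_sum_range fun i : ℕ => Real.cos (m * (2 * Real.pi * i / n) + α)]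
  have h4 : ∀ i : ℕ, Real.cos (m * (2 * Real.pi * i / n) + α)
      = ((ζ ^ m) ^ i * Complex.exp (α * Complex.I)).re := fun i => by
    rw [hζdef, ← Complex.exp_nat_mul, ← Complex.exp_nat_mul, ← Complex.exp_add,
      ← Complex.exp_ofReal_mul_I_re]
    congr 2
    push_cast
    ring
  simp only [h4]
  rw [← Complex.re_sum, ← Finset.sum_mul, h3, zero_mul, Complex.zero_re]

theorem abs_cos_sub_cos_le (x y : ℝ) : |Real.cos x - Real.cos y| ≤ |x - y| := by
  simpa [Real.dist_eq] using (Real.lipschitzWith_cos.dist_le_mul x y)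

theorem abs_sin_sub_sin_le (x y : ℝ) : |Real.sin x - Real.sin y| ≤ |x - y| := by
  simpa [Real.dist_eq] using (Real.lipschitzWith_sin.dist_le_mul x y)

theorem abs_sum_cos_le {n m : ℕ} (hm : 0 < m) (hmn : m < n) (α η : ℝ) (θ : Fin n → ℝ)
    (hθ : ∀ i : Fin n, |θ i - 2 * Real.pi * i / n| ≤ η) :
    |∑ i, Real.cos (m * θ i + α)| ≤ n * (m * η) := by
  have h : ∑ i, Real.cos (m * θ i + α) = ∑ i : Fin n,
      (Real.cos (m * θ i + α) - Real.cos (m * (2 * Real.pi * i / n) + α)) := by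
    rw [Finset.sum_sub_distrib, sum_cos_eq_zero hm hmn, sub_zero]
  rw [h]
  refine (Finset.abs_sum_le_sum_abs _ _).trans ?_
  refine (Finset.sum_le_card_nsmul _ _ (m * η) fun i _ => ?_).trans (by simp)
  refine (abs_cos_sub_cos_le _ _).trans ?_
  rw [add_sub_add_right_eq_sub, ← mul_sub, abs_mul, Nat.abs_cast]
  exact mul_le_mul_of_nonneg_left (hθ i) (Nat.cast_nonneg m)

/-- Cauchy–Schwarz for the increment of the sine, with the energy `∫ cos²` in closed form. -/
theorem sq_sin_sub_sin_le {a b : ℝ} (hab : a ≤ b) :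
    (Real.sin b - Real.sin a) ^ 2 ≤
      (b - a) * ((b / 2 + Real.sin (2 * b) / 4) - (a / 2 + Real.sin (2 * a) / 4)) := by
  rcases hab.eq_or_lt with rfl | hlt
  · simp
  have h0 : 0 < b - a := sub_pos.mpr hlt
  set t := (Real.sin b - Real.sin a) / (b - a) with ht
  -- With t the mean slope, the derivative is (cos x - t)²; its nonnegativity is Cauchy–Schwarz
  -- before integration.
  have hmono : Monotone fun x : ℝ =>
      x / 2 + Real.sin (2 * x) / 4 - 2 * t * Real.sin x + t ^ 2 * x := by
    have hd : ∀ x : ℝ, HasDerivAt (fun x : ℝ =>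
        x / 2 + Real.sin (2 * x) / 4 - 2 * t * Real.sin x + t ^ 2 * x)
        ((Real.cos x - t) ^ 2) x := fun x => by
      have h2 : HasDerivAt (fun x : ℝ => Real.sin (2 * x)) (Real.cos (2 * x) * 2) x := by
        simpa using ((hasDerivAt_id x).const_mul 2).sin
      have h := ((((hasDerivAt_id x).div_const 2).add (h2.div_const 4)).sub
        ((Real.hasDerivAt_sin x).const_mul (2 * t))).add ((hasDerivAt_id x).const_mul (t ^ 2))
      refine h.congr_deriv ?_
      rw [Real.cos_two_mul]
      ring
    exact monotone_of_deriv_nonneg (fun x => (hd x).differentiableAt)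
      fun x => (hd x).deriv ▸ sq_nonneg _
  have h := hmono hlt.le
  simp only at h
  have hs : Real.sin b - Real.sin a = t * (b - a) := by
    rw [ht]
    field_simp
  have h1 : t ^ 2 * (b - a) ≤
      (b / 2 + Real.sin (2 * b) / 4) - (a / 2 + Real.sin (2 * a) / 4) := by
    have : 2 * t * (Real.sin b - Real.sin a) = 2 * (t ^ 2 * (b - a)) := by
      rw [hs]
      ring
    linarith
  rw [hs]
  nlinarith [mul_le_mul_of_nonneg_left h1 h0.le]

/-! ### Arclength angles and the upper bound for λ₂. -/

section Arclength

variable {n : ℕ} {c : Fin n → ℝ}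

theorem res_pos (hc : ∀ i, 0 < c i) (i : Fin n) : 0 < res c i := one_div_pos.mpr (hc i)

theorem mul_res (hc : ∀ i, 0 < c i) (i : Fin n) : c i * res c i = 1 := mul_one_div_cancel (hc i).ne'

variable [NeZero n]

theorem cumRes_succ (c : Fin n → ℝ) (i : ℕ) :
    cumRes c 0 (i + 1) = cumRes c 0 i + res c (Fin.ofNat n i) := by
  simp [cumRes, Finset.sum_range_succ]

theorem cumRes_zero (c : Fin n → ℝ) : cumRes c 0 0 = 0 := by simp [cumRes]

theorem cumRes_self (c : Fin n → ℝ) : cumRes c 0 n = totalRes c := by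
  rw [cumRes, totalRes, ← Fin.sum_univ_eq_sum_range fun j => res c (0 + Fin.ofNat n j)]
  simp

theorem arclength_eq_cumRes (c : Fin n → ℝ) (i : Fin n) : arclength c i = cumRes c 0 i := by
  rw [arclength, cumRes]
  symm
  refine Finset.sum_bij (fun j _ => Fin.ofNat n j) (fun j hj => ?_) (fun j hj k hk h => ?_)
    (fun k hk => ⟨k, ?_, ?_⟩) (fun j hj => by rw [zero_add])
  · rw [Finset.mem_range] at hj
    rw [Finset.mem_Iio, Fin.lt_def]
    simpa [Nat.mod_eq_of_lt (hj.trans i.isLt)] using hj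
  · rw [Finset.mem_range] at hj hk
    simpa [Nat.mod_eq_of_lt (hj.trans i.isLt), Nat.mod_eq_of_lt (hk.trans i.isLt)] using
      congrArg Fin.val h
  · simpa using hk
  · simp

theorem totalRes_pos (hc : ∀ i, 0 < c i) : 0 < totalRes c :=
  Finset.sum_pos (fun i _ => res_pos hc i) Finset.univ_nonempty

theorem maxRes_pos (hc : ∀ i, 0 < c i) : 0 < maxRes c :=
  (res_pos hc 0).trans_le (le_ciSup (Finite.bddAbove_range _) 0)

theorem maxDeviation_nonneg (c : Fin n → ℝ) : 0 ≤ maxDeviation c :=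
  Real.iSup_nonneg fun _ => Real.iSup_nonneg fun _ => abs_nonneg _

/-- The largest resistance is at least the mean. This lets errors of the size of one step, 1/n, be
absorbed into δ. -/
theorem inv_le_discrepancy (hc : ∀ i, 0 < c i) : 1 / (n : ℝ) ≤ discrepancy c := by
  have hn : (0 : ℝ) < n := Nat.cast_pos.mpr (NeZero.pos n)
  have h : totalRes c ≤ n * maxRes c := by
    simpa [totalRes] using Finset.sum_le_card_nsmul Finset.univ (res c) (maxRes c)
      fun i _ => le_ciSup (Finite.bddAbove_range _) i
  have h1 : 1 / (n : ℝ) ≤ maxRes c / totalRes c := by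
    rw [div_le_div_iff₀ hn (totalRes_pos hc)]
    linarith
  exact h1.trans (le_add_of_nonneg_left (div_nonneg (maxDeviation_nonneg c) (totalRes_pos hc).le))

theorem discrepancy_pos (hc : ∀ i, 0 < c i) : 0 < discrepancy c :=
  (one_div_pos.mpr (Nat.cast_pos.mpr (NeZero.pos n))).trans_le (inv_le_discrepancy hc)

theorem abs_cumRes_div_sub_le (hc : ∀ i, 0 < c i) {i : ℕ} (hi : i ≤ n) :
    |cumRes c 0 i / totalRes c - i / n| ≤ discrepancy c := by
  have hS := totalRes_pos hc
  rcases Nat.eq_zero_or_pos i with rfl | hpos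
  · simpa [cumRes_zero] using (discrepancy_pos hc).le
  have h : |cumRes c 0 i - (i : ℝ) / n * totalRes c| ≤ maxDeviation c :=
    (le_ciSup (f := fun ℓ : Set.Icc 1 n => |cumRes c 0 ℓ - ((ℓ : ℕ) : ℝ) / n * totalRes c|)
      (Finite.bddAbove_range _) ⟨i, hpos, hi⟩).trans
    (le_ciSup (f := fun p : Fin n => ⨆ ℓ : Set.Icc 1 n,
      |cumRes c p ℓ - ((ℓ : ℕ) : ℝ) / n * totalRes c|) (Finite.bddAbove_range _) 0)
  have h2 : cumRes c 0 i / totalRes c - i / n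
      = (cumRes c 0 i - (i : ℝ) / n * totalRes c) / totalRes c := by
    field_simp
  rw [h2, abs_div, abs_of_pos hS]
  exact (div_le_div_of_nonneg_right h hS.le).trans
    (le_add_of_nonneg_right (div_nonneg (maxRes_pos hc).le hS.le))

/-- The angle `2π s_i / S` of the vertex `i`. -/
def angle (c : Fin n → ℝ) (i : Fin n) : ℝ := 2 * Real.pi * arclength c i / totalRes c

theorem abs_angle_sub_le (hc : ∀ i, 0 < c i) (i : Fin n) :
    |angle c i - 2 * Real.pi * i / n| ≤ 2 * Real.pi * discrepancy c := by
  have h := abs_cumRes_div_sub_le hc i.isLt.le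
  have h2 : angle c i - 2 * Real.pi * i / n
      = 2 * Real.pi * (cumRes c 0 i / totalRes c - i / n) := by
    rw [angle, arclength_eq_cumRes]
    ring
  rw [h2, abs_mul, abs_of_pos Real.two_pi_pos]
  exact mul_le_mul_of_nonneg_left h Real.two_pi_pos.le

/-- Passing from a vertex to its successor advances a `2π`-periodic function of the angle by the
angle of the edge. -/
theorem periodic_angle_succ (hc : ∀ i, 0 < c i) {f : ℝ → ℝ}
    (hf : Function.Periodic f (2 * Real.pi)) (i : Fin n) :
    f (angle c (i + 1)) = f (2 * Real.pi * cumRes c 0 (i + 1 : ℕ) / totalRes c) := by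
  have hS := (totalRes_pos hc).ne'
  rw [angle, arclength_eq_cumRes]
  rcases Nat.lt_or_ge (i + 1 : ℕ) n with h | h
  · rw [Fin.val_add_one_of_lt' h]
  -- On the closing edge the successor has angle 0 whereas the running sum gives 2π; periodicity of
  -- f reconciles them.
  · have hi : (i + 1 : ℕ) = n := by omega
    have h0 : ((i + 1 : Fin n) : ℕ) = 0 := by
      rw [Fin.val_add, Fin.val_one', Nat.add_mod_mod, hi, Nat.mod_self]
    rw [h0, hi, cumRes_zero, cumRes_self, mul_div_cancel_right₀ _ hS, mul_zero, zero_div]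
    simpa using (hf 0).symm

/-- The constant e drops out of differences. `sq_sin_sub_sin_le` applied to each edge leaves a
telescoping sum of the primitive G of cos², which grows by π over a full turn. -/
theorem energy_sin_le (hc : ∀ i, 0 < c i) (A φ e : ℝ) :
    ∑ i, c i * ((e + A * Real.sin (angle c (i + 1) + φ)) - (e + A * Real.sin (angle c i + φ))) ^ 2
      ≤ A ^ 2 * (2 * Real.pi ^ 2 / totalRes c) := by
  have hS := totalRes_pos hc
  set θ : ℕ → ℝ := fun i => 2 * Real.pi * cumRes c 0 i / totalRes c + φ with hθ
  set G : ℝ → ℝ := fun x => x / 2 + Real.sin (2 * x) / 4 with hG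
  have hstep : ∀ i : Fin n, θ (i + 1) - θ i = 2 * Real.pi / totalRes c * res c i := fun i => by
    simp only [hθ, cumRes_succ, Fin.ofNat_eq_cast, Fin.cast_val_eq_self]
    ring
  have hterm : ∀ i : Fin n,
      c i * ((e + A * Real.sin (angle c (i + 1) + φ)) - (e + A * Real.sin (angle c i + φ))) ^ 2
        ≤ A ^ 2 * (2 * Real.pi / totalRes c) * (G (θ (i + 1)) - G (θ i)) := fun i => by
    have h1 : Real.sin (angle c (i + 1) + φ) = Real.sin (θ (i + 1)) :=
      periodic_angle_succ hc (f := fun x => Real.sin (x + φ))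
        (Real.sin_periodic.add_const φ) i
    have h2 : angle c i + φ = θ i := by simp only [hθ, angle, arclength_eq_cumRes]
    have hpos : 0 ≤ θ (i + 1) - θ i := by
      rw [hstep]
      exact mul_nonneg (div_nonneg Real.two_pi_pos.le hS.le) (res_pos hc i).le
    have h3 := sq_sin_sub_sin_le (sub_nonneg.mp hpos)
    rw [hstep] at h3
    rw [h1, h2]
    calc c i * ((e + A * Real.sin (θ (i + 1))) - (e + A * Real.sin (θ i))) ^ 2
        = c i * A ^ 2 * (Real.sin (θ (i + 1)) - Real.sin (θ i)) ^ 2 := by ring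
      _ ≤ c i * A ^ 2 * (2 * Real.pi / totalRes c * res c i * (G (θ (i + 1)) - G (θ i))) :=
          mul_le_mul_of_nonneg_left h3 (mul_nonneg (hc i).le (sq_nonneg _))
      _ = (c i * res c i) * (A ^ 2 * (2 * Real.pi / totalRes c) * (G (θ (i + 1)) - G (θ i))) := by
          ring
      _ = _ := by rw [mul_res hc, one_mul]
  refine (Finset.sum_le_sum fun i _ => hterm i).trans (le_of_eq ?_)
  rw [← Finset.mul_sum, Fin.sum_univ_eq_sum_range fun i => G (θ (i + 1)) - G (θ i),
    Finset.sum_range_sub fun i => G (θ i)]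
  have hn : θ n = 2 * Real.pi + φ := by
    simp only [hθ, cumRes_self]
    field_simp
  have h0 : θ 0 = φ := by simp [hθ, cumRes_zero]
  have hG2 : G (2 * Real.pi + φ) - G φ = Real.pi := by
    simp only [hG]
    have : 2 * (2 * Real.pi + φ) = 2 * φ + 2 * Real.pi + 2 * Real.pi := by ring
    rw [this, Real.sin_add_two_pi, Real.sin_add_two_pi]
    ring
  rw [hn, h0, hG2]
  ring

/-- Expanding the square leaves the frequency-one and frequency-two cosine sums as the only errors;
both are O(nδ), with 8 standing in for 2π. -/
theorem mass_sin_ge (hn : 3 ≤ n) (hc : ∀ i, 0 < c i) (hδ : 16 * discrepancy c ≤ 1) (A φ e : ℝ) :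
    n * (e ^ 2 * (1 - 8 * discrepancy c) + A ^ 2 / 2 * (1 - 32 * discrepancy c)) ≤
      ∑ i, (e + A * Real.sin (angle c i + φ)) ^ 2 := by
  have hn0 : (0 : ℝ) < n := by positivity
  have hδ0 := discrepancy_pos hc
  have hη : 2 * Real.pi * discrepancy c ≤ 8 * discrepancy c := by nlinarith [Real.pi_lt_four]
  have hθ : ∀ i : Fin n, |angle c i - 2 * Real.pi * i / n| ≤ 8 * discrepancy c :=
    fun i => (abs_angle_sub_le hc i).trans hη
  have h1 := abs_sum_cos_le (m := 1) (by omega) (by omega) (φ - Real.pi / 2) _ _ hθ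
  have h2 := abs_sum_cos_le (m := 2) (by omega) (by omega) (2 * φ) _ _ hθ
  have h3 : ∑ i, (e + A * Real.sin (angle c i + φ)) ^ 2 = n * e ^ 2 + n * (A ^ 2 / 2)
      + 2 * e * A * ∑ i, Real.cos ((1 : ℕ) * angle c i + (φ - Real.pi / 2))
      - A ^ 2 / 2 * ∑ i, Real.cos ((2 : ℕ) * angle c i + 2 * φ) := by
    have : ∀ i, (e + A * Real.sin (angle c i + φ)) ^ 2 = e ^ 2 + A ^ 2 / 2
        + 2 * e * A * Real.cos ((1 : ℕ) * angle c i + (φ - Real.pi / 2))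
        - A ^ 2 / 2 * Real.cos ((2 : ℕ) * angle c i + 2 * φ) := fun i => by
      have h4 : Real.cos ((1 : ℕ) * angle c i + (φ - Real.pi / 2))
          = Real.sin (angle c i + φ) := by
        rw [← Real.cos_sub_pi_div_two]
        congr 1
        push_cast
        ring
      have h5 : Real.cos ((2 : ℕ) * angle c i + 2 * φ)
          = 1 - 2 * Real.sin (angle c i + φ) ^ 2 := by
        have : ((2 : ℕ) : ℝ) * angle c i + 2 * φ = 2 * (angle c i + φ) := by
          push_cast
          ring
        rw [this, Real.cos_two_mul, Real.cos_sq']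
        ring
      rw [h4, h5]
      ring
    simp only [this, Finset.sum_add_distrib, Finset.sum_sub_distrib, ← Finset.mul_sum]
    simp
  rw [h3]
  set X := ∑ i, Real.cos ((1 : ℕ) * angle c i + (φ - Real.pi / 2))
  set Y := ∑ i, Real.cos ((2 : ℕ) * angle c i + 2 * φ)
  set δ := discrepancy c
  push_cast at h1 h2
  have h6 : |2 * e * A * X| ≤ (e ^ 2 + A ^ 2) * (n * (8 * δ)) := by
    rw [abs_mul]
    refine mul_le_mul ?_ (by linarith) (abs_nonneg _) (by positivity)
    rw [abs_le]
    constructor <;> nlinarith [sq_nonneg (e + A), sq_nonneg (e - A)]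
  have h7 : A ^ 2 / 2 * Y ≤ A ^ 2 / 2 * (n * (2 * (8 * δ))) :=
    mul_le_mul_of_nonneg_left ((le_abs_self _).trans h2) (by positivity)
  have h8 := (abs_le.mp h6).1
  nlinarith

theorem exists_polar (a b : ℝ) : ∃ A φ : ℝ, 0 ≤ A ∧ a = A * Real.cos φ ∧ b = A * Real.sin φ := by
  refine ⟨‖(⟨a, b⟩ : ℂ)‖, Complex.arg ⟨a, b⟩, norm_nonneg _, ?_, ?_⟩
  · rw [Complex.norm_mul_cos_arg]
  · rw [Complex.norm_mul_sin_arg]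

theorem lam_two_le (hn : 3 ≤ n) (hc : ∀ i, 0 < c i) (hδ : 64 * discrepancy c ≤ 1) :
    lam c ⟨2, hn⟩ ≤ meanRes c * (2 * Real.pi / totalRes c) ^ 2 *
      (1 + 64 * discrepancy c) := by
  have hS := totalRes_pos hc
  have hn0 : (0 : ℝ) < n := by positivity
  have hδ0 := discrepancy_pos hc
  obtain ⟨x, y, z, hxyz, hray⟩ := exists_rayleigh_le hn c (fun i => Real.sin (angle c i))
    (fun i => Real.cos (angle c i)) 1
  obtain ⟨A, φ, -, rfl, rfl⟩ := exists_polar x y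
  set f : Fin n → ℝ := (A * Real.cos φ) • (fun i => Real.sin (angle c i)) +
    (A * Real.sin φ) • (fun i => Real.cos (angle c i)) + z • 1 with hf
  have hfi : ∀ i, f i = z + A * Real.sin (angle c i + φ) := fun i => by
    simp only [hf, Pi.add_apply, Pi.smul_apply, smul_eq_mul, Pi.one_apply, Real.sin_add]
    ring
  have hE := energy_sin_le hc A φ z
  have hM := mass_sin_ge hn hc (by linarith) A φ z
  rw [dotProduct_cycleLaplacian_mulVec] at hray
  simp only [dotProduct, ← sq, hfi] at hray
  set μ := lam c ⟨2, hn⟩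
  have hμ : 0 ≤ μ := lam_nonneg hc _
  set δ := discrepancy c
  have h1 := (mul_le_mul_of_nonneg_left hM hμ).trans (hray.trans hE)
  have hR : meanRes c * (2 * Real.pi / totalRes c) ^ 2 * n = 4 * Real.pi ^ 2 / totalRes c := by
    rw [meanRes]
    field_simp
    ring
  by_contra! hlt
  have hRpos : 0 < meanRes c * (2 * Real.pi / totalRes c) ^ 2 :=
    mul_pos (div_pos hS hn0) (pow_pos (div_pos Real.two_pi_pos hS) 2)
  set R := meanRes c * (2 * Real.pi / totalRes c) ^ 2
  have h2 : 2 * Real.pi ^ 2 / totalRes c = R * n / 2 := by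
    rw [hR]
    ring
  rw [h2] at h1
  have hμ0 : 0 < μ := lt_of_le_of_lt (by positivity) hlt
  have h3 : μ * (z ^ 2 * (1 - 8 * δ)) + A ^ 2 / 2 * (μ * (1 - 32 * δ) - R) ≤ 0 := by
    have : n * (μ * (z ^ 2 * (1 - 8 * δ)) + A ^ 2 / 2 * (μ * (1 - 32 * δ) - R)) ≤ 0 := by
      linarith
    exact nonpos_of_mul_nonpos_right this hn0
  -- Here (1 + 64δ)(1 - 32δ) = 1 + 32δ(1 - 64δ) ≥ 1. With both quadratic coefficients positive, z
  -- and A must vanish.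
  have h4 : 0 < μ * (1 - 32 * δ) - R := by
    have : R * (1 + 64 * δ) * (1 - 32 * δ) < μ * (1 - 32 * δ) :=
      mul_lt_mul_of_pos_right hlt (by linarith)
    nlinarith [mul_nonneg (mul_nonneg hRpos.le hδ0.le) (by linarith : (0 : ℝ) ≤ 1 - 64 * δ)]
  have h5 : 0 < μ * (1 - 8 * δ) := mul_pos hμ0 (by linarith)
  have hz : z ^ 2 * (μ * (1 - 8 * δ)) = 0 := by
    nlinarith [mul_nonneg (sq_nonneg z) h5.le, mul_nonneg (sq_nonneg A) h4.le]
  have hA : A ^ 2 * (μ * (1 - 32 * δ) - R) = 0 := by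
    nlinarith [mul_nonneg (sq_nonneg z) h5.le, mul_nonneg (sq_nonneg A) h4.le]
  have hz0 : z = 0 := by simpa [h5.ne'] using hz
  have hA0 : A = 0 := by simpa [h4.ne'] using hA
  exact hxyz ⟨by simp [hA0], by simp [hA0], hz0⟩

end Arclength

/-! ### Perturbed rotations and the return angle. -/

/-- A perturbed discrete rotation stays close to the uniform rotation. In the corrected coordinate
`u - T ε v` the step is uniform up to an error of size `h T ε`. -/
theorem norm_sub_rotation_le {n : ℕ} (hn : 0 < n) {h T δ : ℝ} {u v ε : ℕ → ℝ} (hT : T = n * h)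
    (hT0 : 0 ≤ T) (hT7 : T ≤ 7) (hnδ : 1 / (n : ℝ) ≤ δ) (hδ : 602 * δ ≤ 1) (hε0 : ε 0 = 0)
    (hε : ∀ i ≤ n, |ε i| ≤ δ) (hv : ∀ i, v (i + 1) = v i - h * u i)
    (hu : ∀ i, u (i + 1) - T * ε (i + 1) * v (i + 1)
      = u i - T * ε i * v i + h * v (i + 1) + h * T * ε i * u i) :
    ∀ i ≤ n, ‖((v i : ℂ) + (u i : ℂ) * Complex.I)
        - Complex.exp ((i * h : ℝ) * Complex.I) * ((v 0 : ℂ) + (u 0 : ℂ) * Complex.I)‖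
      ≤ 602 * δ * ‖(v 0 : ℂ) + (u 0 : ℂ) * Complex.I‖ := by
  have hn0 : (0 : ℝ) < n := Nat.cast_pos.mpr hn
  have hδ0 : 0 < δ := (one_div_pos.mpr hn0).trans_le hnδ
  have hh : h = T * (1 / n) := by
    rw [hT]
    field_simp
  have hh0 : 0 ≤ h := by rw [hh]; positivity
  have hhδ : h ≤ 7 * δ := by
    rw [hh]
    exact mul_le_mul hT7 hnδ (by positivity) (by norm_num)
  -- All errors are first measured against the maximum M of the orbit, which is compared with the
  -- initial norm only at the end.
  obtain ⟨j, hj, hmax⟩ := Finset.exists_max_image (Finset.range (n + 1))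
    (fun i => max |u i| |v i|) ⟨0, by simp⟩
  set M := max |u j| |v j| with hM
  have hM0 : 0 ≤ M := (abs_nonneg _).trans (le_max_left _ _)
  have hum : ∀ i ≤ n, |u i| ≤ M := fun i hi =>
    (le_max_left _ _).trans (hmax i (by simpa using Nat.lt_succ_of_le hi))
  have hvm : ∀ i ≤ n, |v i| ≤ M := fun i hi =>
    (le_max_right _ _).trans (hmax i (by simpa using Nat.lt_succ_of_le hi))
  have hεm : ∀ i ≤ n, ∀ x : ℝ, |x| ≤ M → |T * ε i * x| ≤ 7 * δ * M := fun i hi x hx => by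
    rw [abs_mul, abs_mul, abs_of_nonneg hT0]
    exact mul_le_mul (mul_le_mul hT7 (hε i hi) (abs_nonneg _) (by norm_num)) hx (abs_nonneg _)
      (by positivity)
  have hnorm : ∀ a b : ℝ, ‖(a : ℂ) + (b : ℂ) * Complex.I‖ ≤ |a| + |b| := fun a b => by
    refine (norm_add_le _ _).trans ?_
    simp
  set z : ℕ → ℂ := fun i => (v i : ℂ) + ((u i - T * ε i * v i : ℝ) : ℂ) * Complex.I with hz
  have hz0 : z 0 = (v 0 : ℂ) + (u 0 : ℂ) * Complex.I := by simp [hz, hε0]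
  -- 42 = 21 + 7 · 3: the perturbation terms, plus the second-order error h² ≤ 7hδ of the
  -- exponential acting on a vector of norm at most 3M.
  have hstep : ∀ i < n, ‖z (i + 1) - Complex.exp (h * Complex.I) * z i‖ ≤ 42 * h * δ * M := by
    intro i hi
    have hsplit : z (i + 1) - Complex.exp (h * Complex.I) * z i
        = (((-(h * (T * ε i * v i)) : ℝ) : ℂ)
            + ((-(h * (h * u i)) + h * (T * ε i * u i) : ℝ) : ℂ) * Complex.I)
          - (Complex.exp (h * Complex.I) - 1 - h * Complex.I) * z i := by
      have hI : Complex.I * Complex.I = -1 := Complex.I_mul_I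
      simp only [hz]
      rw [hu i, hv i]
      push_cast
      linear_combination (-(h * (u i - T * ε i * v i) : ℂ)) * hI
    have h1 := hεm i hi.le _ (hvm i hi.le)
    have h2 := hεm i hi.le _ (hum i hi.le)
    have h3 : |h * u i| ≤ 7 * δ * M := by
      rw [abs_mul, abs_of_nonneg hh0]
      exact mul_le_mul hhδ (hum i hi.le) (abs_nonneg _) (by positivity)
    have h4 : ‖((-(h * (T * ε i * v i)) : ℝ) : ℂ)
        + ((-(h * (h * u i)) + h * (T * ε i * u i) : ℝ) : ℂ) * Complex.I‖ ≤ h * (21 * δ * M) := by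
      refine (hnorm _ _).trans ?_
      have h5 : |-(h * (h * u i)) + h * (T * ε i * u i)| ≤ h * (14 * δ * M) := by
        rw [← mul_neg, ← mul_add, abs_mul, abs_of_nonneg hh0]
        refine mul_le_mul_of_nonneg_left ((abs_add_le _ _).trans ?_) hh0
        rw [abs_neg]
        linarith
      rw [abs_neg, abs_mul, abs_of_nonneg hh0]
      have := mul_le_mul_of_nonneg_left h1 hh0
      linarith
    have h6 : ‖z i‖ ≤ 3 * M := by
      refine (hnorm _ _).trans ?_
      have h7 := abs_sub (u i) (T * ε i * v i)
      have := hum i hi.le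
      have := hvm i hi.le
      nlinarith
    have h8 : ‖Complex.exp (h * Complex.I) - 1 - h * Complex.I‖ ≤ h * (7 * δ) := by
      have hhn : ‖(h : ℂ) * Complex.I‖ = h := by simp [abs_of_nonneg hh0]
      refine (Complex.norm_exp_sub_one_sub_id_le (by rw [hhn]; linarith)).trans ?_
      rw [hhn, sq]
      exact mul_le_mul_of_nonneg_left hhδ hh0
    rw [hsplit]
    refine (norm_sub_le _ _).trans ?_
    rw [norm_mul]
    have := mul_le_mul h8 h6 (norm_nonneg _) (by positivity)
    linarith
  -- Exact rotations are isometries, so the step errors merely add up.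
  have hind : ∀ i ≤ n, ‖z i - Complex.exp ((i * h : ℝ) * Complex.I) * z 0‖
      ≤ i * (42 * h * δ * M) := by
    intro i
    induction i with
    | zero => simp
    | succ i ih =>
      intro hi
      have h1 := ih (by omega)
      have h2 := hstep i (by omega)
      have h3 : z (i + 1) - Complex.exp (((i + 1 : ℕ) * h : ℝ) * Complex.I) * z 0
          = (z (i + 1) - Complex.exp (h * Complex.I) * z i)
            + Complex.exp (h * Complex.I)
              * (z i - Complex.exp ((i * h : ℝ) * Complex.I) * z 0) := by
        have : Complex.exp (((i + 1 : ℕ) * h : ℝ) * Complex.I)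
            = Complex.exp (h * Complex.I) * Complex.exp ((i * h : ℝ) * Complex.I) := by
          rw [← Complex.exp_add]
          congr 1
          push_cast
          ring
        rw [this]
        ring
      rw [h3]
      refine (norm_add_le _ _).trans ?_
      rw [norm_mul, Complex.norm_exp_ofReal_mul_I, one_mul, Nat.cast_succ, add_mul (i : ℝ) 1 (42 * h * δ * M), one_mul]
      linarith
  have hclose : ∀ i ≤ n, ‖z i - Complex.exp ((i * h : ℝ) * Complex.I) * z 0‖ ≤ 294 * δ * M := by
    intro i hi
    refine (hind i hi).trans ?_
    have : (i : ℝ) * h ≤ 7 := by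
      refine le_trans ?_ hT7
      rw [hT]
      exact mul_le_mul_of_nonneg_right (Nat.cast_le.mpr hi) hh0
    have h2 := mul_le_mul_of_nonneg_right this (by positivity : 0 ≤ 42 * δ * M)
    linarith
  have hshift : ∀ i ≤ n, ‖((v i : ℂ) + (u i : ℂ) * Complex.I)
      - Complex.exp ((i * h : ℝ) * Complex.I) * z 0‖ ≤ 301 * δ * M := by
    intro i hi
    have h1 : ((v i : ℂ) + (u i : ℂ) * Complex.I)
        - Complex.exp ((i * h : ℝ) * Complex.I) * z 0
        = (z i - Complex.exp ((i * h : ℝ) * Complex.I) * z 0)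
          + ((T * ε i * v i : ℝ) : ℂ) * Complex.I := by
      simp only [hz]
      push_cast
      ring
    rw [h1]
    refine (norm_add_le _ _).trans ?_
    have h2 := hclose i hi
    have h3 := hεm i hi _ (hvm i hi)
    have h4 : ‖((T * ε i * v i : ℝ) : ℂ) * Complex.I‖ = |T * ε i * v i| := by
      rw [norm_mul, Complex.norm_I, mul_one, Complex.norm_real, Real.norm_eq_abs]
    rw [h4]
    linarith
  -- At the maximising index M ≤ ‖z 0‖ + 301δM, and 602δ ≤ 1 absorbs the last term.
  have hMA : M ≤ 2 * ‖z 0‖ := by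
    have hjn : j ≤ n := by simpa using Nat.lt_succ_iff.mp (Finset.mem_range.mp hj)
    have h1 : M ≤ ‖(v j : ℂ) + (u j : ℂ) * Complex.I‖ := by
      refine max_le ?_ ?_
      · simpa using Complex.abs_im_le_norm ((v j : ℂ) + (u j : ℂ) * Complex.I)
      · simpa using Complex.abs_re_le_norm ((v j : ℂ) + (u j : ℂ) * Complex.I)
    have h2 := norm_le_norm_sub_add ((v j : ℂ) + (u j : ℂ) * Complex.I)
      (Complex.exp ((j * h : ℝ) * Complex.I) * z 0)
    rw [norm_mul, Complex.norm_exp_ofReal_mul_I, one_mul] at h2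
    have h3 := hshift j hjn
    have h4 := mul_le_mul_of_nonneg_right hδ hM0
    linarith
  intro i hi
  have h1 := hshift i hi
  rw [← hz0]
  have h2 := mul_le_mul_of_nonneg_left hMA (by positivity : 0 ≤ 301 * δ)
  linarith

/-- A rotation by an angle of at least `1` and barely more than `2π` that nearly returns to its
start is nearly a full turn. -/
theorem abs_sub_two_pi_le {T δ : ℝ} (hδ : 2000 * δ ≤ 1) (hδ0 : 0 ≤ δ) (hT1 : 1 ≤ T)
    (hT2 : T ≤ 2 * Real.pi * (1 + 32 * δ))
    (hT : ‖Complex.exp (Complex.I * T) - 1‖ ≤ 602 * δ) : |T - 2 * Real.pi| ≤ 1000 * δ := by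
  have hπ := Real.pi_lt_d2
  have hπ3 := Real.pi_gt_three
  rw [Complex.norm_exp_I_mul_ofReal_sub_one, Real.norm_eq_abs, abs_mul, abs_two] at hT
  have hsin : Real.sin (T / 2) ≤ 301 * δ := by
    have := le_abs_self (Real.sin (T / 2))
    linarith
  rw [abs_le]
  refine ⟨?_, by nlinarith⟩
  -- 0.63 is below 2/π. For T ≤ π the bound contradicts T ≥ 1; for T between π and 2π it controls π
  -- - T/2.
  have hjordan : ∀ x, 0 ≤ x → x ≤ Real.pi / 2 → 0.63 * x ≤ Real.sin x := fun x hx hx2 => by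
    refine le_trans (mul_le_mul_of_nonneg_right ?_ hx) (Real.mul_le_sin hx hx2)
    rw [le_div_iff₀ Real.pi_pos]
    linarith
  rcases le_total (T / 2) (Real.pi / 2) with h | h
  · have := hjordan (T / 2) (by linarith) h
    linarith
  · rcases le_total (T / 2) Real.pi with h' | h'
    · have := hjordan (Real.pi - T / 2) (by linarith) (by linarith)
      rw [Real.sin_pi_sub] at this
      linarith
    · linarith

/-! ### Eigenvectors below the bound follow a single rotation. -/

section Eigenvector

variable {n : ℕ} [NeZero n] {c : Fin n → ℝ}

theorem ofNat_succ (i : ℕ) : Fin.ofNat n (i + 1) = Fin.ofNat n i + 1 := by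
  ext
  simp [Fin.val_add]

theorem ofNat_self : Fin.ofNat n n = 0 := by
  ext
  simp

/-- Poincaré inequality for vectors orthogonal to the constants. -/
theorem dotProduct_self_le_energy (hc : ∀ i, 0 < c i) {u : Fin n → ℝ} (hu : u ⬝ᵥ 1 = 0) :
    u ⬝ᵥ u ≤ n * (totalRes c * (u ⬝ᵥ (cycleLaplacian c *ᵥ u))) := by
  have hn : (0 : ℝ) < n := Nat.cast_pos.mpr (NeZero.pos n)
  -- B is the total variation. Cauchy–Schwarz with weights r_i bounds B² by S times the energy, and
  -- zero mean gives |u i| ≤ B.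
  set B := ∑ i, |u (i + 1) - u i| with hB
  have hB2 : B ^ 2 ≤ totalRes c * (u ⬝ᵥ (cycleLaplacian c *ᵥ u)) := by
    rw [dotProduct_cycleLaplacian_mulVec]
    refine Finset.sum_sq_le_sum_mul_sum_of_sq_le_mul _ (fun i _ => (res_pos hc i).le)
      (fun i _ => mul_nonneg (hc i).le (sq_nonneg _)) fun i _ => le_of_eq ?_
    rw [sq_abs, ← mul_assoc, mul_comm (res c i), mul_res hc, one_mul]
  have hdist : ∀ i j : Fin n, i ≤ j → |u i - u j| ≤ B := fun i j hij => by
    have h := dist_le_Ico_sum_dist (fun k : ℕ => u (Fin.ofNat n k)) (Fin.le_def.mp hij)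
    have hval : ∀ k : Fin n, Fin.ofNat n k = k := fun k => by simp
    simp only [Real.dist_eq, hval] at h
    refine h.trans ?_
    have h2 : B = ∑ k ∈ Finset.range n, |u (Fin.ofNat n k) - u (Fin.ofNat n (k + 1))| := by
      rw [hB, ← Fin.sum_univ_eq_sum_range
        fun k : ℕ => |u (Fin.ofNat n k) - u (Fin.ofNat n (k + 1))|]
      refine Finset.sum_congr rfl fun k _ => ?_
      rw [abs_sub_comm, ofNat_succ, hval]
    rw [h2]
    refine Finset.sum_le_sum_of_subset_of_nonneg (fun k hk => ?_) fun _ _ _ => abs_nonneg _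
    exact Finset.mem_range.mpr ((Finset.mem_Ico.mp hk).2.trans j.isLt)
  have hdist' : ∀ i j : Fin n, |u i - u j| ≤ B := fun i j => by
    rcases le_total i j with h | h
    · exact hdist i j h
    · rw [abs_sub_comm]
      exact hdist j i h
  have hbound : ∀ i, |u i| ≤ B := fun i => by
    have h1 : (n : ℝ) * u i = ∑ j, (u i - u j) := by
      have : ∑ j, u j = 0 := by simpa [dotProduct] using hu
      simp [this]
    have h2 : (n : ℝ) * |u i| ≤ n * B := by
      rw [← abs_of_pos hn, ← abs_mul, h1, abs_of_pos hn]
      refine (Finset.abs_sum_le_sum_abs _ _).trans ?_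
      simpa using Finset.sum_le_card_nsmul Finset.univ _ B fun j _ => hdist' i j
    exact le_of_mul_le_mul_left h2 hn
  refine le_trans ?_ (mul_le_mul_of_nonneg_left hB2 hn.le)
  have h3 := Finset.sum_le_card_nsmul Finset.univ (fun i => u i * u i) (B ^ 2) fun i _ => by
    rw [← sq, ← sq_abs (u i)]
    exact pow_le_pow_left₀ (abs_nonneg _) (hbound i) 2
  simpa [dotProduct] using h3

theorem exists_amplitude_near (hc : ∀ i, 0 < c i) (hδ : 2000 * discrepancy c ≤ 1)
    {u : Fin n → ℝ} {μ : ℝ} (hu1 : u ⬝ᵥ u = 1) (hu0 : u ⬝ᵥ 1 = 0)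
    (huL : cycleLaplacian c *ᵥ u = μ • u)
    (hμ : μ ≤ meanRes c * (2 * Real.pi / totalRes c) ^ 2 * (1 + 64 * discrepancy c)) :
    ∃ A φ : ℝ, 0 ≤ A ∧ ∀ i : Fin n,
      |u i - A * Real.sin (2 * Real.pi * i / n + φ)| ≤ 1602 * discrepancy c * A := by
  have hS := totalRes_pos hc
  have hn : (0 : ℝ) < n := Nat.cast_pos.mpr (NeZero.pos n)
  have hδ0 := discrepancy_pos hc
  set δ := discrepancy c
  set S := totalRes c
  have hT1' : 1 ≤ n * S * μ := by
    have h := dotProduct_self_le_energy hc hu0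
    rw [huL, dotProduct_smul, hu1, smul_eq_mul, mul_one] at h
    linarith
  have hμ0 : 0 < μ := pos_of_mul_pos_right (one_pos.trans_le hT1') (by positivity)
  -- T is the total angle turned in n steps; its ideal value is 2π.
  set T := √(n * S * μ) with hT
  have hTsq : T ^ 2 = n * S * μ := Real.sq_sqrt (by positivity)
  have hT1 : 1 ≤ T := Real.one_le_sqrt.mpr hT1'
  have hT0 : 0 < T := one_pos.trans_le hT1
  have hT2 : T ≤ 2 * Real.pi * (1 + 32 * δ) := by
    refine Real.sqrt_le_iff.mpr ⟨by positivity, ?_⟩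
    have h1 := mul_le_mul_of_nonneg_left hμ (by positivity : 0 ≤ n * S)
    have h2 : n * S * (meanRes c * (2 * Real.pi / S) ^ 2 * (1 + 64 * δ))
        = (2 * Real.pi) ^ 2 * (1 + 64 * δ) := by
      have hm : meanRes c = S / n := rfl
      rw [hm]
      field_simp
    rw [h2] at h1
    refine h1.trans ?_
    rw [mul_pow (2 * Real.pi) (1 + 32 * δ)]
    have h3 : 1 + 64 * δ ≤ (1 + 32 * δ) ^ 2 := by nlinarith [sq_nonneg δ]
    exact mul_le_mul_of_nonneg_left h3 (sq_nonneg _)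
  have hT7 : T ≤ 7 := by
    have := Real.pi_lt_d2
    nlinarith
  set h := T / n with hh
  set x : ℕ → ℝ := fun i => u (Fin.ofNat n i) with hx
  -- Current through the edge entering i, scaled by S/T so that both recurrences have rotation form.
  -- Indices wrap, so x and y return to their initial values at n.
  set y : ℕ → ℝ := fun i =>
    S / T * (c (Fin.ofNat n i - 1) * (u (Fin.ofNat n i) - u (Fin.ofNat n i - 1))) with hy
  -- The increment of ε is r_i/S - 1/n, exactly the deviation from a uniform step.
  set ε : ℕ → ℝ := fun i => cumRes c 0 i / S - i / n with hε
  have hxs : ∀ i, x (i + 1) = x i + T * (res c (Fin.ofNat n i) / S) * y (i + 1) := fun i => by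
    have h1 := mul_res hc (Fin.ofNat n i)
    simp only [hx, hy, ofNat_succ, add_sub_cancel_right]
    have h2 : T * (res c (Fin.ofNat n i) / S) * (S / T * (c (Fin.ofNat n i)
        * (u (Fin.ofNat n i + 1) - u (Fin.ofNat n i))))
        = (c (Fin.ofNat n i) * res c (Fin.ofNat n i))
          * (u (Fin.ofNat n i + 1) - u (Fin.ofNat n i)) := by
      field_simp
    rw [h2, h1]
    ring
  have hys : ∀ i, y (i + 1) = y i - h * x i := fun i => by
    have h1 := congrFun huL (Fin.ofNat n i)
    rw [cycleLaplacian_mulVec, Pi.smul_apply, smul_eq_mul] at h1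
    have h2 : h = S / T * μ := by
      rw [hh]
      field_simp
      linarith
    simp only [hx, hy, ofNat_succ, add_sub_cancel_right]
    rw [h2]
    linear_combination (-(S / T)) * h1
  have hεs : ∀ i, ε (i + 1) = ε i + res c (Fin.ofNat n i) / S - 1 / n := fun i => by
    simp only [hε, cumRes_succ]
    push_cast
    ring
  have hrot := norm_sub_rotation_le (NeZero.pos n) (h := h) (T := T) (δ := δ) (u := x) (v := y)
    (ε := ε) (by rw [hh]; field_simp) hT0.le hT7 (inv_le_discrepancy hc) (by linarith)
    (by simp [hε, cumRes_zero]) (fun i hi => abs_cumRes_div_sub_le hc hi) hys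
    (fun i => by
      have h1 := hys i
      rw [hxs i, hεs i]
      have h2 : h = T * (1 / n) := by
        rw [hh]
        ring
      rw [h1, h2]
      ring)
  obtain ⟨A, φ, hA, hAy, hAx⟩ := exists_polar (y 0) (x 0)
  have hz0 : (y 0 : ℂ) + (x 0 : ℂ) * Complex.I = A * Complex.exp (φ * Complex.I) := by
    rw [hAy, hAx, Complex.exp_mul_I]
    push_cast
    ring
  have hz0n : ‖(y 0 : ℂ) + (x 0 : ℂ) * Complex.I‖ = A := by
    rw [hz0, norm_mul, Complex.norm_exp_ofReal_mul_I, mul_one, Complex.norm_real,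
      Real.norm_of_nonneg hA]
  rw [hz0n, hz0] at hrot
  have hclose : ∀ i : Fin n, |u i - A * Real.sin (i * h + φ)| ≤ 602 * δ * A := fun i => by
    refine le_trans ?_ (hrot i i.isLt.le)
    refine le_trans (le_of_eq ?_) (Complex.abs_im_le_norm _)
    have h1 : Complex.exp ((i * h : ℝ) * Complex.I) * (A * Complex.exp (φ * Complex.I))
        = A * Complex.exp ((i * h + φ : ℝ) * Complex.I) := by
      rw [mul_left_comm, ← Complex.exp_add]
      push_cast
      ring_nf
    rw [h1, Complex.sub_im, Complex.im_ofReal_mul, Complex.exp_ofReal_mul_I_im]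
    simp [hx]
  have hA0 : 0 < A := by
    refine lt_of_le_of_ne hA fun hA => ?_
    have : u = 0 := by
      ext i
      simpa [← hA] using hclose i
    simp [this] at hu1
  -- The orbit closes after n steps, so dividing the rotation estimate by A > 0 isolates exp(iT) -
  -- 1.
  have hfull : ‖Complex.exp (Complex.I * T) - 1‖ ≤ 602 * δ := by
    have h1 := hrot n le_rfl
    have h2 : (y n : ℂ) + (x n : ℂ) * Complex.I = A * Complex.exp (φ * Complex.I) := by
      rw [← hz0]
      simp only [hx, hy, ofNat_self]
      rfl
    have h3 : ((n * h : ℝ) : ℂ) * Complex.I = Complex.I * T := by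
      rw [hh, mul_div_cancel₀ _ hn.ne', mul_comm]
    rw [h2, h3, ← one_sub_mul, norm_mul, norm_sub_rev, norm_mul, Complex.norm_exp_ofReal_mul_I,
      mul_one, Complex.norm_real, Real.norm_of_nonneg hA] at h1
    exact le_of_mul_le_mul_right h1 hA0
  have hT2π := abs_sub_two_pi_le hδ hδ0.le hT1 hT2 hfull
  refine ⟨A, φ, hA, fun i => ?_⟩
  have h1 : |Real.sin (i * h + φ) - Real.sin (2 * Real.pi * i / n + φ)| ≤ 1000 * δ := by
    refine (abs_sin_sub_sin_le _ _).trans ?_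
    have h2 : (i * h + φ) - (2 * Real.pi * i / n + φ) = (i / n : ℝ) * (T - 2 * Real.pi) := by
      rw [hh]
      ring
    rw [h2, abs_mul]
    have h3 : |(i / n : ℝ)| ≤ 1 := by
      rw [abs_of_nonneg (by positivity), div_le_one hn]
      exact_mod_cast i.isLt.le
    have := mul_le_mul h3 hT2π (abs_nonneg _) zero_le_one
    linarith
  have h4 := mul_le_mul_of_nonneg_left h1 hA
  rw [← abs_of_nonneg hA, ← abs_mul, abs_of_nonneg hA] at h4
  have h5 : u i - A * Real.sin (2 * Real.pi * i / n + φ) = (u i - A * Real.sin (i * h + φ))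
      + A * (Real.sin (i * h + φ) - Real.sin (2 * Real.pi * i / n + φ)) := by ring
  rw [h5]
  refine (abs_add_le _ _).trans ?_
  have := hclose i
  linarith

end Eigenvector

/-! ### Normalisation of the amplitude and comparison of phases. -/

theorem sum_sq_sin {n : ℕ} (hn : 3 ≤ n) (A φ : ℝ) :
    ∑ i : Fin n, (A * Real.sin (2 * Real.pi * i / n + φ)) ^ 2 = n * (A ^ 2 / 2) := by
  have h : ∀ i : Fin n, (A * Real.sin (2 * Real.pi * i / n + φ)) ^ 2
      = A ^ 2 / 2 - A ^ 2 / 2 * Real.cos ((2 : ℕ) * (2 * Real.pi * i / n) + 2 * φ) := fun i => by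
    have h1 : ((2 : ℕ) : ℝ) * (2 * Real.pi * i / n) + 2 * φ
        = 2 * (2 * Real.pi * i / n + φ) := by
      push_cast
      ring
    rw [h1, Real.cos_two_mul, Real.cos_sq']
    ring
  simp only [h, Finset.sum_sub_distrib, ← Finset.mul_sum]
  rw [sum_cos_eq_zero (by omega) (by omega)]
  simp

theorem sqrt_two_div_mul_sqrt_le {n : ℕ} {δ : ℝ} (hδ : 0 ≤ δ) :
    n * (√(2 / n : ℝ) * √(δ / n)) ≤ 2 * √δ := by
  rcases Nat.eq_zero_or_pos n with rfl | hn
  · simp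
  have hn0 : (0 : ℝ) < n := Nat.cast_pos.mpr hn
  refine abs_le_of_sq_le_sq' ?_ (by positivity) |>.2
  rw [mul_pow, mul_pow, mul_pow, Real.sq_sqrt (by positivity), Real.sq_sqrt (by positivity),
    Real.sq_sqrt hδ]
  have : (n : ℝ) ^ 2 * (2 / n * (δ / n)) = 2 * δ := by
    field_simp
  rw [this]
  linarith

variable {n : ℕ} [NeZero n] {c : Fin n → ℝ}

/-- Eigenvectors with eigenvalue at most about `r̄ (2π / S)²` are sine waves in the arclength. -/
theorem exists_phase_near (hn : 3 ≤ n) (hc : ∀ i, 0 < c i) (hδ : 20000 * discrepancy c ≤ 1)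
    {u : Fin n → ℝ} {μ : ℝ} (hu1 : u ⬝ᵥ u = 1) (hu0 : u ⬝ᵥ 1 = 0)
    (huL : cycleLaplacian c *ᵥ u = μ • u)
    (hμ : μ ≤ meanRes c * (2 * Real.pi / totalRes c) ^ 2 * (1 + 64 * discrepancy c)) :
    ∃ φ : ℝ, ∀ i : Fin n,
      |u i - √(2 / n) * Real.sin (angle c i + φ)| ≤ 40000 * √(discrepancy c / n) := by
  have hn0 : (0 : ℝ) < n := Nat.cast_pos.mpr (NeZero.pos n)
  have hδ0 := discrepancy_pos hc
  obtain ⟨A, φ, hA, hclose⟩ := exists_amplitude_near hc (by linarith) hu1 hu0 huL hμ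
  refine ⟨φ, fun i => ?_⟩
  have hangle := abs_angle_sub_le hc i
  set δ := discrepancy c
  -- 4806 = 3 · 1602: with q the sine wave, |u² - q²| ≤ |u - q| (|u - q| + 2|q|), and the last
  -- factor is at most 3A.
  have hmass : |1 - n * A ^ 2 / 2| ≤ 4806 * δ * (n * A ^ 2) := by
    have h1 : 1 - n * A ^ 2 / 2
        = ∑ i, (u i ^ 2 - (A * Real.sin (2 * Real.pi * i / n + φ)) ^ 2) := by
      rw [Finset.sum_sub_distrib, sum_sq_sin hn, ← hu1]
      simp only [dotProduct, sq]
      ring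
    rw [h1]
    refine (Finset.abs_sum_le_sum_abs _ _).trans ?_
    have h2 := Finset.sum_le_card_nsmul Finset.univ
      (fun i : Fin n => |u i ^ 2 - (A * Real.sin (2 * Real.pi * i / n + φ)) ^ 2|)
      (1602 * δ * A * (3 * A)) fun i _ => by
        have h3 := hclose i
        have h4 : |A * Real.sin (2 * Real.pi * i / n + φ)| ≤ A := by
          rw [abs_mul, abs_of_nonneg hA]
          exact mul_le_of_le_one_right hA (Real.abs_sin_le_one _)
        set q := A * Real.sin (2 * Real.pi * i / n + φ)
        have h5 : u i ^ 2 - q ^ 2 = (u i - q) * ((u i - q) + 2 * q) := by ring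
        rw [h5, abs_mul]
        refine mul_le_mul h3 ?_ (abs_nonneg _) (by positivity)
        have h6 := abs_add_le (u i - q) (2 * q)
        rw [abs_mul, abs_two] at h6
        have h7 : 1602 * δ * A ≤ 1 * A := mul_le_mul_of_nonneg_right (by linarith) hA
        linarith
    refine h2.trans (le_of_eq ?_)
    simp
    ring
  have hA4 : n * A ^ 2 ≤ 4 := by
    have h1 := (abs_le.mp hmass).1
    have h2 : 4806 * δ * (n * A ^ 2) ≤ 1 / 4 * (n * A ^ 2) :=
      mul_le_mul_of_nonneg_right (by linarith) (by positivity)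
    linarith
  set s := √(2 / n : ℝ) with hs
  have hs2 : s ^ 2 = 2 / n := Real.sq_sqrt (by positivity)
  have hs0 : 0 < s := Real.sqrt_pos.mpr (by positivity)
  have hA2s : A ≤ 2 * s := by
    refine abs_le_of_sq_le_sq' ?_ (by positivity) |>.2
    rw [mul_pow, hs2, mul_div_assoc', le_div_iff₀ hn0]
    linarith
  have hAs : |A - s| ≤ 9612 * 2 * δ * s := by
    have h1 : (A - s) * (A + s) = -(1 - n * A ^ 2 / 2) * s ^ 2 := by
      have h2 : (A - s) * (A + s) = A ^ 2 - s ^ 2 := by ring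
      rw [h2, hs2]
      field_simp
      ring
    have h2 : |A - s| * s ≤ 9612 * 2 * δ * s * s := by
      calc |A - s| * s ≤ |A - s| * (A + s) :=
            mul_le_mul_of_nonneg_left (by linarith) (abs_nonneg _)
        _ = |(A - s) * (A + s)| := by rw [abs_mul, abs_of_nonneg (by positivity : 0 ≤ A + s)]
        _ = |1 - n * A ^ 2 / 2| * s ^ 2 := by
            rw [h1, abs_mul, abs_neg, abs_of_nonneg (sq_nonneg s)]
        _ ≤ (4806 * δ * 4) * s ^ 2 :=
            mul_le_mul_of_nonneg_right (hmass.trans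
              (mul_le_mul_of_nonneg_left hA4 (by positivity))) (sq_nonneg s)
        _ = 9612 * 2 * δ * s * s := by ring
    exact le_of_mul_le_mul_right h2 hs0
  have hsin : |Real.sin (2 * Real.pi * i / n + φ) - Real.sin (angle c i + φ)| ≤ 8 * δ := by
    refine (abs_sin_sub_sin_le _ _).trans ?_
    rw [add_sub_add_right_eq_sub, abs_sub_comm]
    have := Real.pi_lt_four
    nlinarith
  have hfin : |u i - s * Real.sin (angle c i + φ)| ≤ 23000 * δ * s := by
    have h1 : u i - s * Real.sin (angle c i + φ)
        = (u i - A * Real.sin (2 * Real.pi * i / n + φ))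
          + A * (Real.sin (2 * Real.pi * i / n + φ) - Real.sin (angle c i + φ))
          + (A - s) * Real.sin (angle c i + φ) := by ring
    rw [h1]
    refine (abs_add_three _ _ _).trans ?_
    rw [abs_mul, abs_mul, abs_of_nonneg hA]
    have h2 := mul_le_mul hA2s hsin (abs_nonneg _) (by positivity)
    have h3 := mul_le_mul hAs (Real.abs_sin_le_one (angle c i + φ)) (abs_nonneg _) (by positivity)
    have h4 := hclose i
    have h5 := mul_le_mul_of_nonneg_left hA2s (by positivity : 0 ≤ 1602 * δ)
    nlinarith [mul_pos hδ0 hs0]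
  refine hfin.trans ?_
  -- δ√(2/n) = √(2δ) √(δ/n): the error obtained is of order δ/√n, finer than the bound claimed.
  have h1 : δ * s ≤ 1.5 * √(δ / n) := by
    refine abs_le_of_sq_le_sq' ?_ (by positivity) |>.2
    rw [mul_pow, mul_pow, hs2, Real.sq_sqrt (by positivity)]
    have h2 : δ ^ 2 * (2 / n) = (δ / n) * (2 * δ) := by ring
    rw [h2, mul_comm]
    exact mul_le_mul_of_nonneg_right (by linarith) (by positivity)
  linarith [Real.sqrt_nonneg (δ / n)]

/-- Orthogonality of two near-sine vectors makes their phases nearly orthogonal. -/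
theorem abs_cos_sub_le (hn : 3 ≤ n) (hc : ∀ i, 0 < c i) (hδ : discrepancy c ≤ 1)
    {u w : Fin n → ℝ} {K φ ψ σ : ℝ} (hK : 0 ≤ K) (hσ : σ = 1 ∨ σ = -1)
    (hu : ∀ i, |u i - σ * √(2 / n) * Real.sin (angle c i + φ)| ≤ K * √(discrepancy c / n))
    (hw : ∀ i, |w i - √(2 / n) * Real.sin (angle c i + ψ)| ≤ K * √(discrepancy c / n))
    (huw : w ⬝ᵥ u = 0) : |Real.cos (φ - ψ)| ≤ (K ^ 2 + 4 * K + 16) * √(discrepancy c) := by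
  have hn0 : (0 : ℝ) < n := Nat.cast_pos.mpr (NeZero.pos n)
  have hδ0 := discrepancy_pos hc
  have hπ := Real.pi_lt_four
  have hX := abs_sum_cos_le (m := 2) (by omega) (by omega) (φ + ψ) _ _ (abs_angle_sub_le hc)
  set δ := discrepancy c
  have hδs : δ ≤ √δ := by
    refine abs_le_of_sq_le_sq' ?_ (by positivity) |>.2
    rw [Real.sq_sqrt hδ0.le]
    nlinarith
  set s := √(2 / n : ℝ) with hs
  set ρ := √(δ / n) with hρ
  have hs0 : 0 ≤ s := Real.sqrt_nonneg _
  have hρ0 : 0 ≤ ρ := Real.sqrt_nonneg _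
  have hs2 : s ^ 2 = 2 / n := Real.sq_sqrt (by positivity)
  have hρ2 : ρ ^ 2 = δ / n := Real.sq_sqrt (by positivity)
  have hsρ : n * (s * ρ) ≤ 2 * √δ := sqrt_two_div_mul_sqrt_le hδ0.le
  have hσ1 : |σ| = 1 := by rcases hσ with rfl | rfl <;> simp
  set a : Fin n → ℝ := fun i => σ * s * Real.sin (angle c i + φ) with ha
  set b : Fin n → ℝ := fun i => s * Real.sin (angle c i + ψ) with hb
  have hal : ∀ i, |a i| ≤ s := fun i => by
    simp only [ha]
    rw [abs_mul, abs_mul, hσ1, one_mul, abs_of_nonneg hs0]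
    exact mul_le_of_le_one_right hs0 (Real.abs_sin_le_one _)
  have hbl : ∀ i, |b i| ≤ s := fun i => by
    simp only [hb]
    rw [abs_mul, abs_of_nonneg hs0]
    exact mul_le_of_le_one_right hs0 (Real.abs_sin_le_one _)
  -- Replacing the orthogonal vectors by their sine models costs 2K√(2/n)√(δ/n) + K²δ/n per vertex,
  -- hence O(√δ) in total.
  have hab : |∑ i, a i * b i| ≤ (K ^ 2 + 4 * K) * √δ := by
    have h1 : ∑ i, a i * b i = -∑ i, (w i * u i - a i * b i) := by
      rw [Finset.sum_sub_distrib]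
      have : ∑ i, w i * u i = 0 := huw
      rw [this]
      ring
    rw [h1, abs_neg]
    refine (Finset.abs_sum_le_sum_abs _ _).trans ?_
    refine (Finset.sum_le_card_nsmul _ _ (2 * (K * (s * ρ)) + K ^ 2 * ρ ^ 2) fun i _ => ?_).trans ?_
    · have h2 : w i * u i - a i * b i
          = (w i - b i) * a i + b i * (u i - a i) + (w i - b i) * (u i - a i) := by ring
      rw [h2]
      refine (abs_add_three _ _ _).trans ?_
      rw [abs_mul _ (a i), abs_mul (b i), abs_mul _ (u i - a i)]
      have h3 := mul_le_mul (hw i) (hal i) (abs_nonneg _) (by positivity)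
      have h4 := mul_le_mul (hbl i) (hu i) (abs_nonneg _) (by positivity)
      have h5 := mul_le_mul (hw i) (hu i) (abs_nonneg _) (by positivity)
      linarith
    · rw [Finset.card_univ, Fintype.card_fin, nsmul_eq_mul, hρ2]
      have h3 : (n : ℝ) * (2 * (K * (s * ρ)) + K ^ 2 * (δ / n))
          = 2 * K * (n * (s * ρ)) + K ^ 2 * δ := by
        field_simp
      rw [h3]
      have h4 := mul_le_mul_of_nonneg_left hsρ (by positivity : 0 ≤ 2 * K)
      have h5 := mul_le_mul_of_nonneg_left hδs (sq_nonneg K)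
      linarith
  -- Product-to-sum, averaged over the vertices; the frequency-two remainder is O(δ).
  have hcos : Real.cos (φ - ψ) = σ * ∑ i, a i * b i
      + 1 / n * ∑ i, Real.cos ((2 : ℕ) * angle c i + (φ + ψ)) := by
    have h1 : ∀ i, σ * (a i * b i)
        = 1 / n * (Real.cos (φ - ψ) - Real.cos ((2 : ℕ) * angle c i + (φ + ψ))) := fun i => by
      have h2 : Real.cos (φ - ψ) - Real.cos ((2 : ℕ) * angle c i + (φ + ψ))
          = 2 * (Real.sin (angle c i + φ) * Real.sin (angle c i + ψ)) := by
        have e1 : φ - ψ = (angle c i + φ) - (angle c i + ψ) := by ring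
        have e2 : ((2 : ℕ) : ℝ) * angle c i + (φ + ψ) = (angle c i + φ) + (angle c i + ψ) := by
          push_cast
          ring
        rw [e1, e2, Real.cos_sub (angle c i + φ), Real.cos_add (angle c i + φ)]
        ring
      have h3 : σ * σ = 1 := by rcases hσ with rfl | rfl <;> norm_num
      simp only [ha, hb]
      rw [h2]
      calc _ = (σ * σ) * s ^ 2 * (Real.sin (angle c i + φ) * Real.sin (angle c i + ψ)) := by ring
        _ = _ := by
          rw [h3, hs2]
          ring
    rw [Finset.mul_sum]
    simp only [h1]
    rw [← Finset.mul_sum, Finset.sum_sub_distrib]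
    simp
    field_simp
    ring
  rw [hcos]
  refine (abs_add_le _ _).trans ?_
  rw [abs_mul, hσ1, one_mul, abs_mul, abs_of_pos (by positivity : (0 : ℝ) < 1 / n)]
  have h6 := mul_le_mul_of_nonneg_left hX (by positivity : (0 : ℝ) ≤ 1 / n)
  have h7 : 1 / (n : ℝ) * (n * ((2 : ℕ) * (2 * Real.pi * δ))) = 4 * Real.pi * δ := by
    push_cast
    field_simp
    norm_num
  rw [h7] at h6
  have h8 : 4 * Real.pi * δ ≤ 16 * √δ := by nlinarith
  linarith

/-- Write angle + ψ as (angle + φ) + (ψ - φ). The sine component has the small coefficient cos(φ -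
ψ), and the cosine component has coefficient sin(ψ - φ), close to the sign τ because 1 - |sin| ≤
|cos|. -/
theorem nearCosine_of_phase (hc : ∀ i, 0 < c i)
    {w : Fin n → ℝ} {K Q φ ψ : ℝ} (hQ : |Real.cos (φ - ψ)| ≤ Q * √(discrepancy c))
    (hw : ∀ i, |w i - √(2 / n) * Real.sin (angle c i + ψ)| ≤ K * √(discrepancy c / n)) :
    ∃ τ : ℝ, (τ = 1 ∨ τ = -1) ∧ NearCosine c (K + 4 * Q) w φ τ := by
  have hn0 : (0 : ℝ) < n := Nat.cast_pos.mpr (NeZero.pos n)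
  have hδ0 := discrepancy_pos hc
  set δ := discrepancy c with hδ
  have hτ : ∃ τ : ℝ, (τ = 1 ∨ τ = -1) ∧ |Real.sin (ψ - φ) - τ| ≤ Q * √δ := by
    have h1 := Real.sin_sq_add_cos_sq (φ - ψ)
    have h2 := Real.abs_cos_le_one (φ - ψ)
    have h3 := Real.abs_sin_le_one (φ - ψ)
    have h4 : Real.sin (ψ - φ) = -Real.sin (φ - ψ) := by rw [← Real.sin_neg, neg_sub]
    rw [h4]
    rw [← sq_abs, ← sq_abs (Real.cos (φ - ψ))] at h1
    have h5 := abs_nonneg (Real.cos (φ - ψ))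
    have h6 := abs_nonneg (Real.sin (φ - ψ))
    have h7 : 1 - |Real.sin (φ - ψ)| ≤ |Real.cos (φ - ψ)| := by nlinarith
    rcases abs_cases (Real.sin (φ - ψ)) with ⟨h, h'⟩ | ⟨h, h'⟩
    · refine ⟨-1, Or.inr rfl, ?_⟩
      rw [abs_le]
      constructor <;> linarith
    · refine ⟨1, Or.inl rfl, ?_⟩
      rw [abs_le]
      constructor <;> linarith
  obtain ⟨τ, hτ1, hτs⟩ := hτ
  refine ⟨τ, hτ1, fun i => ?_⟩
  rw [← hδ]
  change |w i - τ * √(2 / n) * Real.cos (angle c i + φ)| ≤ _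
  have hdiff : |Real.sin (angle c i + ψ) - τ * Real.cos (angle c i + φ)| ≤ 2 * (Q * √δ) := by
    have h1 : Real.sin (angle c i + ψ) = Real.sin (angle c i + φ) * Real.cos (φ - ψ)
        + Real.cos (angle c i + φ) * Real.sin (ψ - φ) := by
      rw [← Real.cos_neg (φ - ψ), neg_sub, ← Real.sin_add]
      congr 1
      ring
    have h2 : Real.sin (angle c i + ψ) - τ * Real.cos (angle c i + φ)
        = Real.sin (angle c i + φ) * Real.cos (φ - ψ)
          + Real.cos (angle c i + φ) * (Real.sin (ψ - φ) - τ) := by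
      rw [h1]
      ring
    rw [h2]
    refine (abs_add_le _ _).trans ?_
    rw [abs_mul, abs_mul]
    have h3 := mul_le_mul (Real.abs_sin_le_one (angle c i + φ)) hQ (abs_nonneg _) zero_le_one
    have h4 := mul_le_mul (Real.abs_cos_le_one (angle c i + φ)) hτs (abs_nonneg _) zero_le_one
    linarith
  have hsq : √(2 / n : ℝ) * √δ ≤ 2 * √(δ / n) := by
    refine abs_le_of_sq_le_sq' ?_ (by positivity) |>.2
    rw [mul_pow, mul_pow, Real.sq_sqrt (by positivity), Real.sq_sqrt hδ0.le,
      Real.sq_sqrt (by positivity)]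
    have : 2 / (n : ℝ) * δ = 2 * (δ / n) := by ring
    rw [this]
    have := div_pos hδ0 hn0
    linarith
  have hQ0 : 0 ≤ Q := by
    have := (abs_nonneg _).trans hQ
    exact nonneg_of_mul_nonneg_left this (Real.sqrt_pos.mpr hδ0)
  have h1 : w i - τ * √(2 / n) * Real.cos (angle c i + φ)
      = (w i - √(2 / n) * Real.sin (angle c i + ψ))
        + √(2 / n) * (Real.sin (angle c i + ψ) - τ * Real.cos (angle c i + φ)) := by ring
  rw [h1]
  refine (abs_add_le _ _).trans ?_
  rw [abs_mul, abs_of_nonneg (Real.sqrt_nonneg _)]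
  have h2 := mul_le_mul_of_nonneg_left hdiff (Real.sqrt_nonneg (2 / n : ℝ))
  have h3 := mul_le_mul_of_nonneg_left hsq hQ0
  have h4 := hw i
  linarith

end WeightedCycle

end

/-! ### Assembly. -/

theorem mainTheorem8 (κ : ℝ) :
    ∃ δ₀ > (0 : ℝ), ∃ C > (0 : ℝ), ∃ C' > (0 : ℝ),
      ∀ (n : ℕ) [NeZero n] (hn : 3 ≤ n) (c : Fin n → ℝ),
        (∀ i, 1 ≤ c i ∧ c i ≤ κ) →
        WeightedCycle.discrepancy c ≤ δ₀ →
        (∀ u₁ : Fin n → ℝ, WeightedCycle.IsUnitEigenvector c ⟨1, by omega⟩ u₁ →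
          (∃ φ σ : ℝ, (σ = 1 ∨ σ = -1) ∧ WeightedCycle.NearSine c C u₁ φ σ) ∧
          (∀ φ σ : ℝ, (σ = 1 ∨ σ = -1) → WeightedCycle.NearSine c C u₁ φ σ →
            ∃ (u₂ : Fin n → ℝ) (τ : ℝ), WeightedCycle.IsUnitEigenvector c ⟨2, by omega⟩ u₂ ∧
              u₂ ⬝ᵥ u₁ = 0 ∧ (τ = 1 ∨ τ = -1) ∧ WeightedCycle.NearCosine c C' u₂ φ τ)) ∧
        WeightedCycle.lam c ⟨1, by omega⟩ ≤
          WeightedCycle.meanRes c * (2 * Real.pi / WeightedCycle.totalRes c) ^ 2 *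
            (1 + C * WeightedCycle.discrepancy c) ∧
        WeightedCycle.lam c ⟨2, by omega⟩ ≤
          WeightedCycle.meanRes c * (2 * Real.pi / WeightedCycle.totalRes c) ^ 2 *
            (1 + C' * WeightedCycle.discrepancy c) := by
  -- C is K = 40000 from `exists_phase_near`, and C' is K + 4Q with Q = K² + 4K + 16 from
  -- `abs_cos_sub_le`; both exceed the 64 of the eigenvalue bound.
  refine ⟨1 / 20000, by norm_num, 40000, by norm_num,
    40000 + 4 * (40000 ^ 2 + 4 * 40000 + 16), by norm_num, ?_⟩
  intro n _ hn c hcκ hδ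
  have hc : ∀ i, 0 < c i := fun i => one_pos.trans_le (hcκ i).1
  have hδ0 := WeightedCycle.discrepancy_pos hc
  have hR : 0 ≤ WeightedCycle.meanRes c * (2 * Real.pi / WeightedCycle.totalRes c) ^ 2 :=
    mul_nonneg (div_nonneg (WeightedCycle.totalRes_pos hc).le (Nat.cast_nonneg n)) (sq_nonneg _)
  have h2 := WeightedCycle.lam_two_le hn hc (by linarith)
  have h1 := (WeightedCycle.lam_mono c
    (show (⟨1, by omega⟩ : Fin n) ≤ ⟨2, by omega⟩ from Nat.le_succ 1)).trans h2
  refine ⟨fun u hu => ⟨?_, fun φ σ hσ hnear => ?_⟩, h1.trans ?_, h2.trans ?_⟩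
  · obtain ⟨φ, hφ⟩ := WeightedCycle.exists_phase_near hn hc (by linarith) hu.1 hu.2.1 hu.2.2 h1
    exact ⟨φ, 1, Or.inl rfl, fun i => by rw [one_mul]; exact hφ i⟩
  · have h0 : (0 : Fin n) < ⟨1, by omega⟩ := by simp [Fin.lt_def]
    have h12 : (⟨1, by omega⟩ : Fin n) < ⟨2, by omega⟩ := Nat.one_lt_two
    obtain ⟨w, hw, hwu⟩ := WeightedCycle.exists_isUnitEigenvector_orthogonal hc h0 h12 hu
    obtain ⟨ψ, hψ⟩ := WeightedCycle.exists_phase_near hn hc (by linarith) hw.1 hw.2.1 hw.2.2 h2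
    have hcos := WeightedCycle.abs_cos_sub_le hn hc (by linarith) (by norm_num) hσ hnear hψ hwu
    obtain ⟨τ, hτ, hcosine⟩ := WeightedCycle.nearCosine_of_phase hc hcos hψ
    exact ⟨w, τ, hw, hwu, hτ, hcosine⟩
  all_goals
    refine mul_le_mul_of_nonneg_left ?_ hR
    linarith
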